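/- Let $P$ be an orthogonal polygon, possibly with holes: a compact region in the plane with connected interior that is the closure of its interior, and whose boundary is a disjoint union of finitely many simple closed polygonal curves with axis-parallel edges, consecutive edges being perpendicular. A sliding camera is a nondegenerate axis-parallel segment $s\subseteq P$; it sees a point $p\in P$ if there is a point $q\in s$ such that $p=q$ or $pq$ is normal to $s$, and the segment $pq$ is contained in $P$. A cover of $P$ is a finite set $C$ of such segments whose cameras together see every point of $P$; its length is $\sum_{s\in C}\mathrm{len}(s)$. An optimal cover (a solution of the minimum-length sliding cameras problem) is a cover of minimum length. Extend both edges at each reflex vertex of $P$ beyond that vertex, into the interior, until they hit the boundary. Let $S(P)$ be the set of these extended edges together with the edges of $P$ neither of whose endpoints is reflex. The segments in $S(P)$ partition $P$ into a set $R(P)$ of closed rectangles. Let $B(P)$ be the set of segments into which the segments in $S(P)$ divide those edges of $P$ that are vertical with $P$ immediately to their left, or horizontal with $P$ immediately above them. Let $G_P$ be the graph with vertex set $B(P)$ in which two distinct pieces are adjacent if and only if there is a rectangle in $R(P)$ all of whose points are seen by each of the two pieces (as cameras). The weight of a vertex is the length of the piece, and $w(S)=\sum_{s\in S}\mathrm{len}(s)$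 for $S\subseteq B(P)$. Then $B(P)$ is finite, and the minimum-length sliding cameras problem on $P$ is equivalent to the minimum-weight vertex cover problem on $G_P$, with equal costs: 1. A set $S\subseteq B(P)$ is a vertex cover of $G_P$ if and only if it is a cover of $P$, and its length as a set of cameras equals its weight $w(S)$. In particular, every vertex cover gives a cover of $P$ of equal total length, and every cover of $P$ contained in $B(P)$ is a vertex cover of equal weight. 2. For every cover $C$ of $P$ there is a vertex cover $S$ of $G_P$ with $w(S)\le\sum_{s\in C}\mathrm{len}(s)$, and with equality if $C$ is optimal. 3. A set $S\subseteq B(P)$ is a minimum-weight vertex cover of $G_P$ if and only if it is an optimal cover of $P$. 4. The minimum weight of a vertex cover of $G_P$ and the minimum length of a cover of $P$ are both attained, and they are equal. -/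

import Mathlib

open Set Filter Topology

noncomputable section

/-- The two orientations of an orthogonal (axis-parallel) line segment. -/
inductive Orientation2 where
  | horizontal
  | vertical

/-- A nondegenerate axis-parallel closed line segment in the plane: `level` is the constant
coordinate, and the other coordinate ranges over `[lo, hi]`. -/
structure OrthoSegment where
  dir : Orientation2
  level : ℝ
  lo : ℝ
  hi : ℝ
  lo_lt_hi : lo < hi

namespace OrthoSegment

/-- The point with parameter `t` on the line spanned by `s`. -/
def pt (s : OrthoSegment) (t : ℝ) : ℝ × ℝ :=
  match s.dir with
  | .horizontal => (t, s.level)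
  | .vertical => (s.level, t)

/-- The coordinate of `p` along the direction of `s`. -/
def param (s : OrthoSegment) (p : ℝ × ℝ) : ℝ :=
  match s.dir with
  | .horizontal => p.1
  | .vertical => p.2

/-- The segment as a set of points. -/
def toSet (s : OrthoSegment) : Set (ℝ × ℝ) := s.pt '' Icc s.lo s.hi

/-- The two endpoints. -/
def endpoints (s : OrthoSegment) : Set (ℝ × ℝ) := {s.pt s.lo, s.pt s.hi}

def length (s : OrthoSegment) : ℝ := s.hi - s.lo

end OrthoSegment

/-- An orthogonal polygon, possibly with holes, as a closed region of the plane together with its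
set of edges. The region is compact, is the closure of its interior, and has connected interior.
Its boundary is the union of the edges, distinct edges meet only in common endpoints, and every
endpoint of an edge is an endpoint of exactly two edges, which are perpendicular. Thus the boundary
is a disjoint union of finitely many simple closed orthogonal polygonal curves (the outer boundary
and the boundaries of the holes). -/
structure OrthogonalPolygon where
  carrier : Set (ℝ × ℝ)
  edges : Finset OrthoSegment
  isCompact_carrier : IsCompact carrier
  closure_interior : closure (interior carrier) = carrier
  isConnected_interior : IsConnected (interior carrier)
  frontier_eq : frontier carrier = ⋃ e ∈ edges, e.toSet
  inter_subset_endpoints : ∀ e ∈ edges, ∀ f ∈ edges, e ≠ f →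
    e.toSet ∩ f.toSet ⊆ e.endpoints ∩ f.endpoints
  exists_perpendicular : ∀ e ∈ edges, ∀ v ∈ e.endpoints, ∃ f ∈ edges,
    f.dir ≠ e.dir ∧ v ∈ f.endpoints ∧ ∀ g ∈ edges, v ∈ g.endpoints → g = e ∨ g = f

namespace OrthogonalPolygon

variable (P : OrthogonalPolygon)

/-! ### Sliding cameras -/

/-- The camera travelling along `s` sees `p`: there is a point `q` of `s` such that the segment
`qp` is normal to `s` (or `q = p`) and is contained in the polygon. -/
def Sees (s : OrthoSegment) (p : ℝ × ℝ) : Prop :=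
  ∃ q ∈ s.toSet, s.param q = s.param p ∧ segment ℝ q p ⊆ P.carrier

/-- A cover: a finite set of orthogonal segments contained in the polygon whose cameras
collectively see every point of the polygon. -/
def IsCover (C : Finset OrthoSegment) : Prop :=
  (∀ s ∈ C, s.toSet ⊆ P.carrier) ∧ ∀ p ∈ P.carrier, ∃ s ∈ C, P.Sees s p

/-- The total length of the trajectories in `C`. -/
def totalLength (C : Finset OrthoSegment) : ℝ := ∑ s ∈ C, s.length

/-- A cover of minimum total length. -/
def IsOptimalCover (C : Finset OrthoSegment) : Prop :=
  P.IsCover C ∧ ∀ C', P.IsCover C' → totalLength C ≤ totalLength C'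

/-! ### The partition into rectangles -/

/-- The vertices of the polygon. -/
def vertices : Set (ℝ × ℝ) := ⋃ e ∈ P.edges, e.endpoints

/-- Near `v`, the open quadrant at `v` with signs `σ` is contained in the polygon. -/
def OccupiesQuadrant (v σ : ℝ × ℝ) : Prop :=
  ∃ ε > 0, ∀ x ∈ Ioo 0 ε, ∀ y ∈ Ioo 0 ε, (v.1 + σ.1 * x, v.2 + σ.2 * y) ∈ P.carrier

/-- A reflex vertex, that is, one with interior angle `3π/2`: exactly one of the four quadrants at
the vertex is not occupied by the polygon. -/
def IsReflexVertex (v : ℝ × ℝ) : Prop :=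
  v ∈ P.vertices ∧ ∃! σ : ℝ × ℝ,
    (σ.1 = 1 ∨ σ.1 = -1) ∧ (σ.2 = 1 ∨ σ.2 = -1) ∧ ¬ P.OccupiesQuadrant v σ

/-- `s` is the edge `e` after `e` has been extended inward beyond each of its endpoints that is a
reflex vertex, until the extension hits the boundary. If neither endpoint is reflex, `s` is `e`. -/
def IsExtendedEdge (e s : OrthoSegment) : Prop :=
  s.dir = e.dir ∧ s.level = e.level ∧
  (P.IsReflexVertex (e.pt e.lo) → s.lo < e.lo ∧ e.pt s.lo ∈ frontier P.carrier ∧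
    ∀ t ∈ Ioo s.lo e.lo, e.pt t ∈ interior P.carrier) ∧
  (¬ P.IsReflexVertex (e.pt e.lo) → s.lo = e.lo) ∧
  (P.IsReflexVertex (e.pt e.hi) → e.hi < s.hi ∧ e.pt s.hi ∈ frontier P.carrier ∧
    ∀ t ∈ Ioo e.hi s.hi, e.pt t ∈ interior P.carrier) ∧
  (¬ P.IsReflexVertex (e.pt e.hi) → s.hi = e.hi)

/-- The set `S(P)` of extended edges and of edges without a reflex endpoint. -/
def extendedEdges : Set OrthoSegment := {s | ∃ e ∈ P.edges, P.IsExtendedEdge e s}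

/-- The points of the polygon on none of the segments of `S(P)`. -/
def cutRegion : Set (ℝ × ℝ) := P.carrier \ ⋃ s ∈ P.extendedEdges, s.toSet

/-- The set `R(P)` of closed rectangles into which the segments of `S(P)` partition the polygon:
the closures of the connected components of what remains after these segments are removed. -/
def rectangles : Set (Set (ℝ × ℝ)) :=
  {R | ∃ x ∈ P.cutRegion, R = closure (connectedComponentIn P.cutRegion x)}

/-! ### The boundary pieces and the graph -/

/-- The edge `e` is immediately to the right of the polygon (`e` vertical, with the polygon on its
left) or immediately below it (`e` horizontal, with the polygon above it). -/
def IsRightOrBottom (e : OrthoSegment) : Prop :=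
  ∀ t ∈ Ioo e.lo e.hi, ∀ᶠ δ : ℝ in 𝓝[>] 0,
    match e.dir with
    | .horizontal => (t, e.level + δ) ∈ P.carrier
    | .vertical => (e.level - δ, t) ∈ P.carrier

/-- `v` lies on a segment of `S(P)` perpendicular to `e`. -/
def IsCutPoint (e : OrthoSegment) (v : ℝ × ℝ) : Prop :=
  ∃ s ∈ P.extendedEdges, s.dir ≠ e.dir ∧ v ∈ s.toSet

/-- The set `B(P)` of pieces into which the segments of `S(P)` partition the right and bottom
edges: segments between consecutive cut points on such an edge. -/
def boundaryPieces : Set OrthoSegment :=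
  {b | ∃ e ∈ P.edges, P.IsRightOrBottom e ∧
    b.dir = e.dir ∧ b.level = e.level ∧ e.lo ≤ b.lo ∧ b.hi ≤ e.hi ∧
    P.IsCutPoint e (e.pt b.lo) ∧ P.IsCutPoint e (e.pt b.hi) ∧
    ∀ t ∈ Ioo b.lo b.hi, ¬ P.IsCutPoint e (e.pt t)}

/-- The camera travelling along `s` sees all of `R`. -/
def SeesRegion (s : OrthoSegment) (R : Set (ℝ × ℝ)) : Prop := ∀ p ∈ R, P.Sees s p

/-- The graph `G_P` on the boundary pieces: two distinct pieces are adjacent if both see a common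
rectangle of `R(P)`. -/
def pieceGraph : SimpleGraph P.boundaryPieces where
  Adj a b := a ≠ b ∧ ∃ R ∈ P.rectangles, P.SeesRegion a R ∧ P.SeesRegion b R
  symm := ⟨fun _ _ h => ⟨h.1.symm, h.2.imp fun _ hR => ⟨hR.1, hR.2.2, hR.2.1⟩⟩⟩
  loopless := ⟨fun _ h => h.1 rfl⟩

variable {P}

/-- The total weight of a set of vertices of `G_P`; the weight of a piece is its length. -/
def weight (S : Finset P.boundaryPieces) : ℝ := ∑ b ∈ S, b.1.length

/-- The set of segments that corresponds to a set of vertices of `G_P`. -/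
def segmentsOf (S : Finset P.boundaryPieces) : Finset OrthoSegment :=
  S.map (Function.Embedding.subtype _)

/-- A vertex cover of `G_P` of minimum weight. -/
def IsMinWeightVertexCover (S : Finset P.boundaryPieces) : Prop :=
  P.pieceGraph.IsVertexCover (S : Set P.boundaryPieces) ∧
    ∀ S' : Finset P.boundaryPieces, P.pieceGraph.IsVertexCover (S' : Set P.boundaryPieces) →
      weight S ≤ weight S'

end OrthogonalPolygon

end

/-!
Call an interior point generic if neither its horizontal nor its vertical line carries an edge of
the polygon. Generic points are dense (`frequently_generic`), and the set of points that a camera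
sees is closed (`isClosed_sees`), so covers of the polygon and visibility of whole rectangles can be
tested on generic points.

The downward chord of a generic point ends on exactly one horizontal piece and its rightward chord
on exactly one vertical piece (`exists_lands`), and no other pieces see the point
(`lands_of_sees`). Both landing pieces stay the same throughout a rectangle
(`Lands.of_mem_component`), so the edges of `G_P` are exactly the pairs of landing pieces of
generic points. A vertex cover is therefore a set of pieces that contains a landing piece of every
generic point (`isVertexCover_iff`), that is, a cover (`isVertexCover_iff_isCover`).

For an arbitrary cover `C`, take the pieces that are seen, at almost all their points, by cameras of
`C` parallel to them. Were neither landing piece `b`, `b'` of a generic point taken, there would be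
unseen positions on both. Above `b` and `b'` the polygon contains the whole product of the two
parameter intervals (`Lands.exists_common`), so some generic point has its chords landing at these
two positions, and no camera of `C` sees it. Hence the taken pieces form a vertex cover. They
weigh at most the length of `C`, because a camera sees at most one parallel piece at each generic
parameter (`weight_le_of_isSwept`).

The geometric input is `exists_crossing_or_edge`: a rectangle in the interior that is blocked by
the boundary along one side is either blocked by a single edge, or crossed by the extension of an
edge from a reflex vertex on that side. Statements of this kind are proved once for both
orientations and both directions, with coordinates along and across an orientation and a sign `σ`
that selects the direction.
-/

/-! ### Coordinates adapted to an orientation -/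

/-- The point whose coordinate along the orientation `d` is `t` and whose other coordinate
is `u`. -/
def Orientation2.point (d : Orientation2) (t u : ℝ) : ℝ × ℝ :=
  match d with
  | .horizontal => (t, u)
  | .vertical => (u, t)

/-- The coordinate of `p` along the orientation `d`. -/
def Orientation2.along (d : Orientation2) (p : ℝ × ℝ) : ℝ :=
  match d with
  | .horizontal => p.1
  | .vertical => p.2

/-- The coordinate of `p` perpendicular to the orientation `d`. -/
def Orientation2.across (d : Orientation2) (p : ℝ × ℝ) : ℝ :=
  match d with
  | .horizontal => p.2
  | .vertical => p.1

/-- The sign of the side of a bottom edge (for `d` horizontal) or of a right edge (for `d`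
vertical) on which the polygon lies. -/
def Orientation2.sgn (d : Orientation2) : ℝ :=
  match d with
  | .horizontal => 1
  | .vertical => -1

namespace Orientation2

@[simp] lemma along_point (d : Orientation2) (t u : ℝ) : d.along (d.point t u) = t := by
  cases d <;> rfl

@[simp] lemma across_point (d : Orientation2) (t u : ℝ) : d.across (d.point t u) = u := by
  cases d <;> rfl

@[simp] lemma point_along_across (d : Orientation2) (p : ℝ × ℝ) :
    d.point (d.along p) (d.across p) = p := by
  cases d <;> rfl

lemma point_of_ne {d d' : Orientation2} (h : d ≠ d') (t u : ℝ) : d.point t u = d'.point u t := by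
  cases d <;> cases d' <;> first | rfl | exact absurd rfl h

lemma along_of_ne {d d' : Orientation2} (h : d ≠ d') (p : ℝ × ℝ) : d.along p = d'.across p := by
  cases d <;> cases d' <;> first | rfl | exact absurd rfl h

lemma eq_of_ne_of_ne {d d₁ d₂ : Orientation2} (h₁ : d₁ ≠ d) (h₂ : d₂ ≠ d) : d₁ = d₂ := by
  cases d <;> cases d₁ <;> cases d₂ <;> simp_all

lemma exists_ne (d : Orientation2) : ∃ d', d' ≠ d := by
  cases d
  exacts [⟨.vertical, nofun⟩, ⟨.horizontal, nofun⟩]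

lemma sgn_eq (d : Orientation2) : d.sgn = 1 ∨ d.sgn = -1 := by
  cases d <;> simp [sgn]

lemma sgn_mul_sgn_mul (d : Orientation2) (x : ℝ) :
    d.sgn * (d.sgn * x) = x := by
  cases d <;> simp [sgn]

lemma sgn_mul_mem_uIcc (d : Orientation2) {x a b : ℝ} (hx : x ∈ uIcc a b) :
    d.sgn * x ∈ uIcc (d.sgn * a) (d.sgn * b) := by
  rw [mem_uIcc] at hx ⊢
  rcases d.sgn_eq with h | h <;> rw [h] <;> rcases hx with hx | hx
  · left; constructor <;> linarith
  · right; constructor <;> linarith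
  · right; constructor <;> linarith
  · left; constructor <;> linarith

@[fun_prop] lemma continuous_along (d : Orientation2) : Continuous d.along := by
  cases d
  exacts [continuous_fst, continuous_snd]

@[fun_prop] lemma continuous_across (d : Orientation2) : Continuous d.across := by
  cases d
  exacts [continuous_snd, continuous_fst]

@[fun_prop] lemma continuous_point (d : Orientation2) {X : Type*} [TopologicalSpace X]
    {f g : X → ℝ} (hf : Continuous f) (hg : Continuous g) :
    Continuous fun x => d.point (f x) (g x) := by
  cases d
  exacts [hf.prodMk hg, hg.prodMk hf]

/-- Balls for the sup distance are squares. -/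
lemma mem_ball_iff (d : Orientation2) {p q : ℝ × ℝ} {r : ℝ} :
    q ∈ Metric.ball p r ↔
      |d.along q - d.along p| < r ∧ |d.across q - d.across p| < r := by
  cases d <;> simp [Metric.mem_ball, Prod.dist_eq, Real.dist_eq, along, across, and_comm]

lemma segment_point (d : Orientation2) (t a b : ℝ) :
    segment ℝ (d.point t a) (d.point t b) = d.point t '' uIcc a b := by
  cases d
  · simp only [point]
    rw [← Prod.image_mk_segment_right, segment_eq_uIcc]
    rfl
  · simp only [point]
    rw [← Prod.image_mk_segment_left, segment_eq_uIcc]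
    rfl

end Orientation2

namespace OrthoSegment

lemma pt_eq_point (s : OrthoSegment) (t : ℝ) : s.pt t = s.dir.point t s.level := by
  unfold pt Orientation2.point
  cases s.dir <;> rfl

lemma param_eq_along (s : OrthoSegment) (p : ℝ × ℝ) : s.param p = s.dir.along p := by
  unfold param Orientation2.along
  cases s.dir <;> rfl

lemma mem_toSet (s : OrthoSegment) {p : ℝ × ℝ} :
    p ∈ s.toSet ↔ s.dir.across p = s.level ∧ s.dir.along p ∈ Icc s.lo s.hi := by
  constructor
  · rintro ⟨t, ht, rfl⟩
    simpa [pt_eq_point] using ht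
  · rintro ⟨h1, h2⟩
    exact ⟨s.dir.along p, h2, by rw [pt_eq_point, ← h1]; simp⟩

lemma point_mem_toSet {s : OrthoSegment} {d : Orientation2} (h : s.dir = d) {t u : ℝ} :
    d.point t u ∈ s.toSet ↔ u = s.level ∧ t ∈ Icc s.lo s.hi := by
  subst h
  simp [mem_toSet]

lemma point_mem_toSet_of_ne {s : OrthoSegment} {d : Orientation2} (h : s.dir ≠ d) {t u : ℝ} :
    d.point t u ∈ s.toSet ↔ t = s.level ∧ u ∈ Icc s.lo s.hi := by
  rw [Orientation2.point_of_ne h.symm, point_mem_toSet rfl]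

lemma point_mem_endpoints {s : OrthoSegment} {d : Orientation2} (h : s.dir = d) {t u : ℝ} :
    d.point t u ∈ s.endpoints ↔ u = s.level ∧ (t = s.lo ∨ t = s.hi) := by
  subst h
  have key : ∀ x y, s.dir.point t u = s.dir.point x y ↔ t = x ∧ u = y := by
    intro x y
    cases s.dir <;> simp [Orientation2.point, and_comm]
  simp only [endpoints, pt_eq_point, mem_insert_iff, mem_singleton_iff, key]
  tauto

lemma point_mem_endpoints_of_ne {s : OrthoSegment} {d : Orientation2} (h : s.dir ≠ d) {t u : ℝ} :
    d.point t u ∈ s.endpoints ↔ t = s.level ∧ (u = s.lo ∨ u = s.hi) := by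
  rw [Orientation2.point_of_ne h.symm, point_mem_endpoints rfl]

lemma endpoints_subset_toSet (s : OrthoSegment) : s.endpoints ⊆ s.toSet := by
  rintro v (rfl | rfl)
  exacts [⟨_, left_mem_Icc.2 s.lo_lt_hi.le, rfl⟩, ⟨_, right_mem_Icc.2 s.lo_lt_hi.le, rfl⟩]

lemma isClosed_toSet (s : OrthoSegment) : IsClosed s.toSet := by
  have : s.toSet = s.dir.across ⁻¹' {s.level} ∩ s.dir.along ⁻¹' Icc s.lo s.hi := by
    ext p
    simp [mem_toSet]
  rw [this]
  exact (isClosed_singleton.preimage (by fun_prop)).inter (isClosed_Icc.preimage (by fun_prop))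

end OrthoSegment

namespace OrthogonalPolygon

variable {P : OrthogonalPolygon}

/-! ### The boundary near an edge and near a vertex -/

lemma isClosed_carrier (P : OrthogonalPolygon) : IsClosed P.carrier := P.isCompact_carrier.isClosed

lemma mem_frontier_iff {p : ℝ × ℝ} : p ∈ frontier P.carrier ↔ ∃ e ∈ P.edges, p ∈ e.toSet := by
  simp [P.frontier_eq]

lemma frontier_subset (P : OrthogonalPolygon) : frontier P.carrier ⊆ P.carrier :=
  P.isClosed_carrier.frontier_subset

lemma mem_interior_iff {p : ℝ × ℝ} :
    p ∈ interior P.carrier ↔ p ∈ P.carrier ∧ p ∉ frontier P.carrier := by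
  rw [← self_sdiff_frontier, Set.mem_sdiff]

lemma notMem_frontier {p : ℝ × ℝ} (h : p ∈ interior P.carrier) : p ∉ frontier P.carrier :=
  (mem_interior_iff.1 h).2

/-- A connected set that avoids the boundary and meets the polygon lies in its interior. -/
lemma subset_interior_of_isPreconnected {A : Set (ℝ × ℝ)} (hA : IsPreconnected A)
    (hf : ∀ p ∈ A, p ∉ frontier P.carrier) {q : ℝ × ℝ} (hq : q ∈ A) (hqP : q ∈ P.carrier) :
    A ⊆ interior P.carrier := by
  intro p hp
  refine mem_interior_iff.2 ⟨?_, hf p hp⟩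
  by_contra hpc
  have h := hA.subset_or_subset (u := interior P.carrier) (v := P.carrierᶜ) isOpen_interior
    P.isClosed_carrier.isOpen_compl
    (disjoint_compl_right.mono_left interior_subset) (fun x hx => by
      by_cases hxP : x ∈ P.carrier
      · exact Or.inl (mem_interior_iff.2 ⟨hxP, hf x hx⟩)
      · exact Or.inr hxP)
  rcases h with h | h
  · exact hpc (interior_subset (h hp))
  · exact h hq hqP

/-- Near a point, only the edges through that point meet the boundary. -/
lemma exists_ball_frontier (P : OrthogonalPolygon) (p : ℝ × ℝ) :
    ∃ ε > 0, ∀ q ∈ Metric.ball p ε, q ∈ frontier P.carrier →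
      ∃ e ∈ P.edges, p ∈ e.toSet ∧ q ∈ e.toSet := by
  have hcl : IsClosed (⋃ e ∈ {e | e ∈ P.edges ∧ p ∉ e.toSet}, e.toSet) :=
    (P.edges.finite_toSet.subset fun e he => he.1).isClosed_biUnion fun e _ => e.isClosed_toSet
  have hmem : (⋃ e ∈ {e | e ∈ P.edges ∧ p ∉ e.toSet}, e.toSet)ᶜ ∈ 𝓝 p := by
    refine hcl.isOpen_compl.mem_nhds ?_
    simp only [mem_compl_iff, mem_iUnion, not_exists]
    exact fun e he hp => he.2 hp
  obtain ⟨ε, hε, hball⟩ := Metric.mem_nhds_iff.1 hmem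
  refine ⟨ε, hε, fun q hq hqf => ?_⟩
  obtain ⟨e, he, hqe⟩ := mem_frontier_iff.1 hqf
  refine ⟨e, he, ?_, hqe⟩
  by_contra hpe
  exact hball hq (mem_biUnion (show e ∈ {e | e ∈ P.edges ∧ p ∉ e.toSet} from ⟨he, hpe⟩) hqe)

lemma eq_of_mem_Ioo {e g : OrthoSegment} (he : e ∈ P.edges) (hg : g ∈ P.edges) {t : ℝ}
    (ht : t ∈ Ioo e.lo e.hi) (hmem : e.dir.point t e.level ∈ g.toSet) : g = e := by
  by_contra hne
  have h := (P.inter_subset_endpoints e he g hg (Ne.symm hne)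
    ⟨(OrthoSegment.point_mem_toSet rfl).2 ⟨rfl, Ioo_subset_Icc_self ht⟩, hmem⟩).1
  rcases ((OrthoSegment.point_mem_endpoints rfl).1 h).2 with h | h
  · exact ht.1.ne' h
  · exact ht.2.ne h

/-- A closed interval in the relative interior of an edge has a neighbourhood in which the
boundary is contained in the line of the edge. -/
lemma exists_tube {e : OrthoSegment} (he : e ∈ P.edges) {t₁ t₂ : ℝ} (h₁ : e.lo < t₁)
    (h₂ : t₂ < e.hi) : ∃ ε > 0, ∀ x ∈ Icc t₁ t₂, ∀ u, |u - e.level| < ε → u ≠ e.level →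
      e.dir.point x u ∉ frontier P.carrier := by
  set K : Set (ℝ × ℝ) := (fun x => e.dir.point x e.level) '' Icc t₁ t₂ with hK
  have hKc : IsCompact K := isCompact_Icc.image (by fun_prop)
  have hcl : IsClosed (⋃ g ∈ {g | g ∈ P.edges ∧ g ≠ e}, g.toSet) :=
    (P.edges.finite_toSet.subset fun g hg => hg.1).isClosed_biUnion fun g _ => g.isClosed_toSet
  have hsub : K ⊆ (⋃ g ∈ {g | g ∈ P.edges ∧ g ≠ e}, g.toSet)ᶜ := by
    rintro _ ⟨x, hx, rfl⟩
    simp only [mem_compl_iff, mem_iUnion, not_exists]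
    exact fun g hg hmem => hg.2
      (eq_of_mem_Ioo he hg.1 ⟨h₁.trans_le hx.1, hx.2.trans_lt h₂⟩ hmem)
  obtain ⟨ε, hε, hth⟩ := hKc.exists_thickening_subset_open hcl.isOpen_compl hsub
  refine ⟨ε, hε, fun x hx u hu hne hfr => ?_⟩
  have hmem : e.dir.point x u ∈ Metric.thickening ε K := by
    rw [Metric.mem_thickening_iff]
    refine ⟨_, ⟨x, hx, rfl⟩, ?_⟩
    rw [← Metric.mem_ball, e.dir.mem_ball_iff]
    simpa using ⟨hε, hu⟩
  obtain ⟨g, hg, hgm⟩ := mem_frontier_iff.1 hfr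
  by_cases hge : g = e
  · subst hge
    exact hne ((OrthoSegment.point_mem_toSet rfl).1 hgm).1
  · exact hth hmem (mem_biUnion (show g ∈ {g | g ∈ P.edges ∧ g ≠ e} from ⟨hg, hge⟩) hgm)

/-- If the polygon lies on the side `σ` of an edge at one point of its relative interior, then it
does so uniformly on every compact part of the relative interior. -/
lemma exists_side_subset_interior {e : OrthoSegment} (he : e ∈ P.edges) {σ : ℝ}
    (hσ : σ = 1 ∨ σ = -1) {x₀ : ℝ} (hx₀ : x₀ ∈ Ioo e.lo e.hi)
    (hside : ∀ ε > 0, ∃ δ ∈ Ioo 0 ε, e.dir.point x₀ (e.level + σ * δ) ∈ P.carrier)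
    {t₁ t₂ : ℝ} (h₁ : e.lo < t₁) (h₂ : t₂ < e.hi) :
    ∃ ε > 0, ∀ x ∈ Icc t₁ t₂, ∀ δ ∈ Ioo 0 ε,
      e.dir.point x (e.level + σ * δ) ∈ interior P.carrier := by
  obtain ⟨ε, hε, htube⟩ := exists_tube he (lt_min h₁ hx₀.1) (max_lt h₂ hx₀.2)
  obtain ⟨δ₀, hδ₀, hmem⟩ := hside ε hε
  refine ⟨ε, hε, fun x hx δ hδ => ?_⟩
  have hpre : IsPreconnected ((fun y : ℝ × ℝ => e.dir.point y.1 (e.level + σ * y.2)) ''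
      (Icc (min t₁ x₀) (max t₂ x₀) ×ˢ Ioo 0 ε)) :=
    (isPreconnected_Icc.prod isPreconnected_Ioo).image _ (by fun_prop)
  refine subset_interior_of_isPreconnected hpre ?_
    ⟨(x₀, δ₀), ⟨⟨min_le_right _ _, le_max_right _ _⟩, hδ₀⟩, rfl⟩ hmem
    ⟨(x, δ), ⟨⟨(min_le_left _ _).trans hx.1, hx.2.trans (le_max_left _ _)⟩, hδ⟩, rfl⟩
  rintro _ ⟨⟨y, δ⟩, ⟨hy, hδ⟩, rfl⟩
  have hδ' : 0 < δ ∧ δ < ε := hδ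
  refine htube y hy _ ?_ ?_
  · rcases hσ with rfl | rfl <;> simp [abs_of_pos hδ'.1, hδ'.2]
  · rcases hσ with rfl | rfl <;> simp [hδ'.1.ne']

/-- The polygon does not lie on both sides of an edge. -/
lemma not_both_sides {e : OrthoSegment} (he : e ∈ P.edges) {x₀ : ℝ} (hx₀ : x₀ ∈ Ioo e.lo e.hi)
    (hside : ∀ σ : ℝ, (σ = 1 ∨ σ = -1) → ∀ ε > 0, ∃ δ ∈ Ioo 0 ε,
      e.dir.point x₀ (e.level + σ * δ) ∈ P.carrier) : False := by
  obtain ⟨t₁, ht₁, ht₁'⟩ := exists_between hx₀.1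
  obtain ⟨t₂, ht₂, ht₂'⟩ := exists_between hx₀.2
  obtain ⟨ε₁, hε₁, h₁⟩ := exists_side_subset_interior he (Or.inl rfl) hx₀
    (hside 1 (Or.inl rfl)) ht₁ ht₂'
  obtain ⟨ε₂, hε₂, h₂⟩ := exists_side_subset_interior he (Or.inr rfl) hx₀
    (hside (-1) (Or.inr rfl)) ht₁ ht₂'
  have hfr : e.dir.point x₀ e.level ∈ frontier P.carrier :=
    mem_frontier_iff.2 ⟨e, he, (OrthoSegment.point_mem_toSet rfl).2
      ⟨rfl, Ioo_subset_Icc_self hx₀⟩⟩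
  refine notMem_frontier ?_ hfr
  rw [mem_interior_iff_mem_nhds, Metric.mem_nhds_iff]
  refine ⟨min (min ε₁ ε₂) (min (x₀ - t₁) (t₂ - x₀)), by
    simp only [gt_iff_lt, lt_min_iff]; refine ⟨⟨hε₁, hε₂⟩, ?_, ?_⟩ <;> linarith, fun q hq => ?_⟩
  rw [e.dir.mem_ball_iff] at hq
  simp only [Orientation2.along_point, Orientation2.across_point, lt_min_iff, abs_lt] at hq
  have hqx : e.dir.along q ∈ Icc t₁ t₂ := ⟨by linarith [hq.1.2.1.1], by linarith [hq.1.2.2.2]⟩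
  rw [← e.dir.point_along_across q]
  rcases lt_trichotomy (e.dir.across q) e.level with h | h | h
  · have := h₂ _ hqx (e.level - e.dir.across q) ⟨by linarith, by linarith [hq.2.1.2.1]⟩
    rw [show e.level + -1 * (e.level - e.dir.across q) = e.dir.across q by ring] at this
    exact interior_subset this
  · refine P.frontier_subset (mem_frontier_iff.2 ⟨e, he, (OrthoSegment.point_mem_toSet rfl).2
      ⟨h, ht₁.le.trans hqx.1, hqx.2.trans ht₂'.le⟩⟩)
  · have := h₁ _ hqx (e.dir.across q - e.level) ⟨by linarith, by linarith [hq.2.1.1.2]⟩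
    rw [show e.level + 1 * (e.dir.across q - e.level) = e.dir.across q by ring] at this
    exact interior_subset this

/-- At every vertex exactly two edges meet the vertex, one of each orientation. -/
lemma exists_edges_at_vertex {v : ℝ × ℝ} (hv : v ∈ P.vertices) (d : Orientation2) :
    ∃ e ∈ P.edges, ∃ f ∈ P.edges, e.dir = d ∧ f.dir ≠ d ∧ v ∈ e.endpoints ∧ v ∈ f.endpoints ∧
      ∀ g ∈ P.edges, v ∈ g.toSet → g = e ∨ g = f := by
  obtain ⟨e, he, hve⟩ : ∃ e ∈ P.edges, v ∈ e.endpoints := by simpa [vertices] using hv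
  obtain ⟨f, hf, hdir, hvf, huniq⟩ := P.exists_perpendicular e he v hve
  have key : ∀ g ∈ P.edges, v ∈ g.toSet → g = e ∨ g = f := by
    intro g hg hvg
    by_cases hge : g = e
    · exact Or.inl hge
    · exact huniq g hg (P.inter_subset_endpoints g hg e he hge
        ⟨hvg, e.endpoints_subset_toSet hve⟩).1
  by_cases hd : e.dir = d
  · exact ⟨e, he, f, hf, hd, hd ▸ hdir, hve, hvf, key⟩
  · exact ⟨f, hf, e, he, Orientation2.eq_of_ne_of_ne hdir (Ne.symm hd), hd, hvf, hve,
      fun g hg h => (key g hg h).symm⟩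

/-! ### Reflex vertices and extended edges -/

lemma occupiesQuadrant_point (d : Orientation2) {t u a b : ℝ} :
    P.OccupiesQuadrant (d.point t u) (d.point a b) ↔
      ∃ ε > 0, ∀ x ∈ Ioo 0 ε, ∀ y ∈ Ioo 0 ε, d.point (t + a * x) (u + b * y) ∈ P.carrier := by
  cases d
  · rfl
  · constructor
    · rintro ⟨ε, hε, h⟩
      exact ⟨ε, hε, fun x hx y hy => h y hy x hx⟩
    · rintro ⟨ε, hε, h⟩
      exact ⟨ε, hε, fun x hx y hy => h y hy x hx⟩

lemma isReflexVertex_of_quadrants (d : Orientation2) {t u a b : ℝ} (ha : a = 1 ∨ a = -1)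
    (hb : b = 1 ∨ b = -1) (hv : d.point t u ∈ P.vertices)
    (h₀ : ¬ P.OccupiesQuadrant (d.point t u) (d.point a b))
    (h₁ : P.OccupiesQuadrant (d.point t u) (d.point (-a) b))
    (h₂ : ∀ c : ℝ, (c = 1 ∨ c = -1) → P.OccupiesQuadrant (d.point t u) (d.point c (-b))) :
    P.IsReflexVertex (d.point t u) := by
  refine ⟨hv, d.point a b, ⟨?_, ?_, h₀⟩, ?_⟩
  · cases d
    exacts [ha, hb]
  · cases d
    exacts [hb, ha]
  · rintro σ ⟨hσ₁, hσ₂, hσ⟩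
    have hal : d.along σ = 1 ∨ d.along σ = -1 := by
      cases d
      exacts [hσ₁, hσ₂]
    have hac : d.across σ = 1 ∨ d.across σ = -1 := by
      cases d
      exacts [hσ₂, hσ₁]
    have flip : ∀ x y : ℝ, (x = 1 ∨ x = -1) → (y = 1 ∨ y = -1) → x ≠ y → x = -y := by
      rintro x y (rfl | rfl) (rfl | rfl) h <;> simp_all
    rw [← d.point_along_across σ] at hσ
    by_cases hb' : d.across σ = b
    · by_cases ha' : d.along σ = a
      · rw [← d.point_along_across σ, ha', hb']
      · rw [hb', flip _ _ hal ha ha'] at hσ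
        exact absurd h₁ hσ
    · rw [flip _ _ hac hb hb'] at hσ
      exact absurd (h₂ _ hal) hσ

/-- At a reflex vertex, on either side of a line through the vertex at least one quadrant is
occupied. -/
lemma IsReflexVertex.exists_occupiesQuadrant (d : Orientation2) {t u : ℝ}
    (hv : P.IsReflexVertex (d.point t u)) {a : ℝ} (ha : a = 1 ∨ a = -1) :
    ∃ b : ℝ, (b = 1 ∨ b = -1) ∧ P.OccupiesQuadrant (d.point t u) (d.point a b) := by
  by_contra! h
  have h₁ := h 1 (Or.inl rfl)
  have h₂ := h (-1) (Or.inr rfl)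
  have hpt : d.point a 1 = d.point a (-1) := by
    refine hv.2.unique ⟨?_, ?_, h₁⟩ ⟨?_, ?_, h₂⟩ <;> cases d <;>
      simp [Orientation2.point, ha]
  have := congrArg d.across hpt
  norm_num at this

/-- A ray from an interior point hits the boundary a first time. -/
lemma exists_first_hit (d : Orientation2) {a b σ : ℝ} (hσ : σ = 1 ∨ σ = -1)
    (h : d.point a b ∈ interior P.carrier) :
    ∃ l > 0, d.point (a + σ * l) b ∈ frontier P.carrier ∧
      ∀ x ∈ Ico 0 l, d.point (a + σ * x) b ∈ interior P.carrier := by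
  set H : Set ℝ := {x | 0 ≤ x ∧ d.point (a + σ * x) b ∈ frontier P.carrier} with hH
  have hcl : IsClosed H :=
    isClosed_Ici.inter (isClosed_frontier.preimage (by fun_prop))
  have hbdd : BddBelow H := ⟨0, fun x hx => hx.1⟩
  have hint : ∀ A : Set ℝ, IsPreconnected A → (0 : ℝ) ∈ A → (∀ x ∈ A, 0 ≤ x) →
      (∀ x ∈ A, x ∉ H) → ∀ x ∈ A, d.point (a + σ * x) b ∈ interior P.carrier := by
    intro A hA h0 hpos hAH x hx
    refine subset_interior_of_isPreconnected
      (hA.image (fun x => d.point (a + σ * x) b) (by fun_prop)) ?_ ⟨0, h0, rfl⟩ ?_ ⟨x, hx, rfl⟩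
    · rintro _ ⟨y, hy, rfl⟩ hfr
      exact hAH y hy ⟨hpos y hy, hfr⟩
    · simpa using interior_subset h
  have hne : H.Nonempty := by
    by_contra hemp
    rw [not_nonempty_iff_eq_empty] at hemp
    have hall := hint (Ici 0) isPreconnected_Ici (mem_Ici.2 le_rfl) (fun x hx => hx) (by simp [hemp])
    obtain ⟨M, hM⟩ := (P.isCompact_carrier.image d.continuous_along).isBounded.exists_norm_le
    have hM' := hM _ ⟨_, interior_subset (hall (|a| + |M| + 1)
      (by rw [mem_Ici]; positivity)), rfl⟩
    rw [Orientation2.along_point, Real.norm_eq_abs, abs_le] at hM'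
    have h1 := neg_abs_le a
    have h2 := le_abs_self a
    have h3 := le_abs_self M
    rcases hσ with rfl | rfl <;> linarith
  have hmem := hcl.csInf_mem hne hbdd
  have hpos : 0 < sInf H := by
    refine lt_of_le_of_ne hmem.1 fun h0 => ?_
    rw [← h0] at hmem
    refine notMem_frontier h ?_
    simpa using hmem.2
  exact ⟨sInf H, hpos, hmem.2, hint (Ico 0 (sInf H)) isPreconnected_Ico ⟨le_rfl, hpos⟩
    (fun x hx => hx.1) fun x hx hxH => hx.2.not_ge (csInf_le hbdd hxH)⟩

/-- An edge can be extended beyond a reflex endpoint until it hits the boundary. -/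
lemma exists_extension {e : OrthoSegment} (he : e ∈ P.edges) {σ u : ℝ}
    (hu : σ = -1 ∧ u = e.lo ∨ σ = 1 ∧ u = e.hi) (hv : P.IsReflexVertex (e.pt u)) :
    ∃ l > 0, e.pt (u + σ * l) ∈ frontier P.carrier ∧
      ∀ x ∈ Ioo 0 l, e.pt (u + σ * x) ∈ interior P.carrier := by
  have hσ : σ = 1 ∨ σ = -1 := hu.symm.imp And.left And.left
  simp only [OrthoSegment.pt_eq_point] at hv ⊢
  obtain ⟨e', he', f, hf, hdir, hfdir, hve', hvf, huniq⟩ := exists_edges_at_vertex hv.1 e.dir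
  have hve : e.dir.point u e.level ∈ e.toSet := by
    refine (OrthoSegment.point_mem_toSet rfl).2 ⟨rfl, ?_⟩
    rcases hu with ⟨-, rfl⟩ | ⟨-, rfl⟩ <;> simp [e.lo_lt_hi.le]
  have hee : e = e' := by
    rcases huniq e he hve with h | h
    · exact h
    · exact absurd (by rw [h]) hfdir
  subst hee
  have hfl := ((OrthoSegment.point_mem_endpoints_of_ne hfdir).1 hvf).1
  obtain ⟨ε, hε, hball⟩ := P.exists_ball_frontier (e.dir.point u e.level)
  obtain ⟨b, hb, ε', hε', hocc⟩ :
      ∃ b : ℝ, (b = 1 ∨ b = -1) ∧ ∃ ε' > 0, ∀ x ∈ Ioo 0 ε', ∀ y ∈ Ioo 0 ε',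
        e.dir.point (u + σ * x) (e.level + b * y) ∈ P.carrier := by
    obtain ⟨b, hb, h⟩ := hv.exists_occupiesQuadrant e.dir hσ
    exact ⟨b, hb, (occupiesQuadrant_point e.dir).1 h⟩
  -- The start of the extension borders an occupied quadrant, so it lies in the closed polygon.
  have hstart : ∀ x ∈ Ioo 0 (min ε ε'), e.dir.point (u + σ * x) e.level ∈ interior P.carrier := by
    intro x hx
    have hxε : x < ε := hx.2.trans_le (min_le_left _ _)
    refine mem_interior_iff.2 ⟨?_, fun hfr => ?_⟩
    · have hlim : Tendsto (fun y => e.dir.point (u + σ * x) (e.level + b * y)) (𝓝[>] 0)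
          (𝓝 (e.dir.point (u + σ * x) (e.level + b * 0))) := by
        refine tendsto_nhdsWithin_of_tendsto_nhds (Continuous.tendsto ?_ 0)
        fun_prop
      rw [mul_zero, add_zero] at hlim
      refine P.isClosed_carrier.mem_of_tendsto hlim ?_
      filter_upwards [Ioo_mem_nhdsGT hε'] with y hy
      exact hocc x ⟨hx.1, hx.2.trans_le (min_le_right _ _)⟩ y hy
    · obtain ⟨g, hg, hvg, hgm⟩ := hball _ (by
        rw [e.dir.mem_ball_iff]
        rcases hσ with rfl | rfl <;> simp [abs_of_pos hx.1, hxε, hε]) hfr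
      rcases huniq g hg hvg with rfl | rfl
      · have := ((OrthoSegment.point_mem_toSet rfl).1 hgm).2
        rcases hu with ⟨rfl, rfl⟩ | ⟨rfl, rfl⟩
        · linarith [this.1, hx.1]
        · linarith [this.2, hx.1]
      · have := ((OrthoSegment.point_mem_toSet_of_ne hfdir).1 hgm).1
        rw [← hfl] at this
        rcases hσ with rfl | rfl <;> linarith [hx.1]
  set x₀ := min ε ε' / 2 with hx₀
  have hpos : 0 < min ε ε' := lt_min hε hε'
  obtain ⟨l, hl, hfr, hint⟩ := exists_first_hit e.dir hσ (hstart x₀ ⟨by positivity, by linarith⟩)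
  refine ⟨x₀ + l, by positivity, ?_, fun x hx => ?_⟩
  · convert hfr using 2
    ring
  · by_cases hxx : x < x₀
    · exact hstart x ⟨hx.1, by linarith⟩
    · have := hint (x - x₀) ⟨by linarith, by linarith [hx.2]⟩
      convert this using 2
      ring

lemma exists_isExtendedEdge {e : OrthoSegment} (he : e ∈ P.edges) :
    ∃ s, P.IsExtendedEdge e s := by
  obtain ⟨lo, hlo, hlo₁, hlo₂⟩ : ∃ lo ≤ e.lo, (P.IsReflexVertex (e.pt e.lo) → lo < e.lo ∧
      e.pt lo ∈ frontier P.carrier ∧ ∀ t ∈ Ioo lo e.lo, e.pt t ∈ interior P.carrier) ∧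
      (¬ P.IsReflexVertex (e.pt e.lo) → lo = e.lo) := by
    by_cases h : P.IsReflexVertex (e.pt e.lo)
    · obtain ⟨l, hl, hfr, hint⟩ := exists_extension he (Or.inl ⟨rfl, rfl⟩) h
      refine ⟨e.lo + -1 * l, by linarith, fun _ => ⟨by linarith, hfr, fun t ht => ?_⟩,
        fun h' => absurd h h'⟩
      have := hint (e.lo - t) ⟨by linarith [ht.2], by linarith [ht.1]⟩
      rwa [show e.lo + -1 * (e.lo - t) = t by ring] at this
    · exact ⟨e.lo, le_rfl, fun h' => absurd h' h, fun _ => rfl⟩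
  obtain ⟨hi, hhi, hhi₁, hhi₂⟩ : ∃ hi ≥ e.hi, (P.IsReflexVertex (e.pt e.hi) → e.hi < hi ∧
      e.pt hi ∈ frontier P.carrier ∧ ∀ t ∈ Ioo e.hi hi, e.pt t ∈ interior P.carrier) ∧
      (¬ P.IsReflexVertex (e.pt e.hi) → hi = e.hi) := by
    by_cases h : P.IsReflexVertex (e.pt e.hi)
    · obtain ⟨l, hl, hfr, hint⟩ := exists_extension he (Or.inr ⟨rfl, rfl⟩) h
      refine ⟨e.hi + 1 * l, by linarith, fun _ => ⟨by linarith, hfr, fun t ht => ?_⟩,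
        fun h' => absurd h h'⟩
      have := hint (t - e.hi) ⟨by linarith [ht.1], by linarith [ht.2]⟩
      rwa [show e.hi + 1 * (t - e.hi) = t by ring] at this
    · exact ⟨e.hi, le_rfl, fun h' => absurd h' h, fun _ => rfl⟩
  exact ⟨⟨e.dir, e.level, lo, hi, by linarith [e.lo_lt_hi]⟩, rfl, rfl, hlo₁, hlo₂, hhi₁, hhi₂⟩

lemma IsExtendedEdge.eq {e s s' : OrthoSegment} (h : P.IsExtendedEdge e s)
    (h' : P.IsExtendedEdge e s') : s = s' := by
  obtain ⟨hd, hl, ha, hb, hc, hd'⟩ := h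
  obtain ⟨kd, kl, ka, kb, kc, kd'⟩ := h'
  have hlo : s.lo = s'.lo := by
    by_cases hr : P.IsReflexVertex (e.pt e.lo)
    · obtain ⟨h₁, h₂, h₃⟩ := ha hr
      obtain ⟨k₁, k₂, k₃⟩ := ka hr
      rcases lt_trichotomy s.lo s'.lo with h | h | h
      · exact absurd k₂ (notMem_frontier (h₃ _ ⟨h, k₁⟩))
      · exact h
      · exact absurd h₂ (notMem_frontier (k₃ _ ⟨h, h₁⟩))
    · rw [hb hr, kb hr]
  have hhi : s.hi = s'.hi := by
    by_cases hr : P.IsReflexVertex (e.pt e.hi)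
    · obtain ⟨h₁, h₂, h₃⟩ := hc hr
      obtain ⟨k₁, k₂, k₃⟩ := kc hr
      rcases lt_trichotomy s.hi s'.hi with h | h | h
      · exact absurd h₂ (notMem_frontier (k₃ _ ⟨h₁, h⟩))
      · exact h
      · exact absurd k₂ (notMem_frontier (h₃ _ ⟨k₁, h⟩))
    · rw [hd' hr, kd' hr]
  have hdir := hd.trans kd.symm
  have hlev := hl.trans kl.symm
  cases s
  cases s'
  simp_all

lemma finite_extendedEdges (P : OrthogonalPolygon) : P.extendedEdges.Finite := by
  have : P.extendedEdges = ⋃ e ∈ (P.edges : Set OrthoSegment), {s | P.IsExtendedEdge e s} := by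
    ext s
    simp [extendedEdges]
  rw [this]
  exact P.edges.finite_toSet.biUnion fun e _ =>
    Set.Subsingleton.finite fun s hs s' hs' => IsExtendedEdge.eq hs hs'

lemma IsExtendedEdge.lo_le {e s : OrthoSegment} (h : P.IsExtendedEdge e s) : s.lo ≤ e.lo := by
  by_cases hr : P.IsReflexVertex (e.pt e.lo)
  · exact (h.2.2.1 hr).1.le
  · exact (h.2.2.2.1 hr).le

lemma IsExtendedEdge.le_hi {e s : OrthoSegment} (h : P.IsExtendedEdge e s) : e.hi ≤ s.hi := by
  by_cases hr : P.IsReflexVertex (e.pt e.hi)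
  · exact (h.2.2.2.2.1 hr).1.le
  · exact (h.2.2.2.2.2 hr).ge

lemma IsExtendedEdge.subset {e s : OrthoSegment} (h : P.IsExtendedEdge e s) :
    e.toSet ⊆ s.toSet := by
  intro p hp
  rw [OrthoSegment.mem_toSet] at hp ⊢
  rw [h.1, h.2.1]
  exact ⟨hp.1, h.lo_le.trans hp.2.1, hp.2.2.trans h.le_hi⟩

lemma frontier_subset_extendedEdges (P : OrthogonalPolygon) :
    frontier P.carrier ⊆ ⋃ s ∈ P.extendedEdges, s.toSet := by
  intro p hp
  obtain ⟨e, he, hpe⟩ := mem_frontier_iff.1 hp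
  obtain ⟨s, hs⟩ := exists_isExtendedEdge he
  exact mem_biUnion (show s ∈ P.extendedEdges from ⟨e, he, hs⟩) (hs.subset hpe)

lemma edge_subset_frontier {e : OrthoSegment} (he : e ∈ P.edges) :
    e.toSet ⊆ frontier P.carrier :=
  fun _ hp => mem_frontier_iff.2 ⟨e, he, hp⟩

/-- The endpoints of an extended edge lie on the boundary. -/
lemma endpoints_subset_frontier {s : OrthoSegment} (hs : s ∈ P.extendedEdges) :
    s.pt s.lo ∈ frontier P.carrier ∧ s.pt s.hi ∈ frontier P.carrier := by
  obtain ⟨e, he, h⟩ := hs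
  have hpt : ∀ t, s.pt t = e.pt t := fun t => by
    rw [OrthoSegment.pt_eq_point, OrthoSegment.pt_eq_point, h.1, h.2.1]
  rw [hpt, hpt]
  constructor
  · by_cases hr : P.IsReflexVertex (e.pt e.lo)
    · exact (h.2.2.1 hr).2.1
    · rw [h.2.2.2.1 hr]
      exact edge_subset_frontier he ⟨_, left_mem_Icc.2 e.lo_lt_hi.le, rfl⟩
  · by_cases hr : P.IsReflexVertex (e.pt e.hi)
    · exact (h.2.2.2.2.1 hr).2.1
    · rw [h.2.2.2.2.2 hr]
      exact edge_subset_frontier he ⟨_, right_mem_Icc.2 e.lo_lt_hi.le, rfl⟩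

lemma extendedEdge_subset {s : OrthoSegment} (hs : s ∈ P.extendedEdges) :
    s.toSet ⊆ P.carrier := by
  have hends := endpoints_subset_frontier hs
  obtain ⟨e, he, h⟩ := hs
  have hpt : ∀ t, s.pt t = e.pt t := fun t => by
    rw [OrthoSegment.pt_eq_point, OrthoSegment.pt_eq_point, h.1, h.2.1]
  rintro _ ⟨t, ht, rfl⟩
  by_cases h₁ : t < e.lo
  · rcases ht.1.eq_or_lt with h₀ | h₀
    · exact P.frontier_subset (h₀ ▸ hends.1)
    · by_cases hr : P.IsReflexVertex (e.pt e.lo)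
      · rw [hpt]
        exact interior_subset ((h.2.2.1 hr).2.2 t ⟨h₀, h₁⟩)
      · rw [h.2.2.2.1 hr] at h₀
        exact absurd h₀ h₁.le.not_gt
  · by_cases h₂ : e.hi < t
    · rcases ht.2.eq_or_lt with h₀ | h₀
      · exact P.frontier_subset (h₀ ▸ hends.2)
      · by_cases hr : P.IsReflexVertex (e.pt e.hi)
        · rw [hpt]
          exact interior_subset ((h.2.2.2.2.1 hr).2.2 t ⟨h₂, h₀⟩)
        · rw [h.2.2.2.2.2 hr] at h₀
          exact absurd h₀ h₂.le.not_gt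
    · rw [hpt]
      exact P.frontier_subset (edge_subset_frontier he ⟨t, ⟨not_lt.1 h₁, not_lt.1 h₂⟩, rfl⟩)

lemma mem_vertices {e : OrthoSegment} (he : e ∈ P.edges) {v : ℝ × ℝ} (hv : v ∈ e.endpoints) :
    v ∈ P.vertices := by
  simp only [vertices, mem_iUnion]
  exact ⟨e, he, hv⟩

/-- A vertex both of whose lower quadrants lie in the interior, where `σ` fixes the meaning of
"lower", is reflex, and the extension of its perpendicular edge crosses the region below. -/
lemma exists_extendedEdge_of_vertex (d : Orientation2) {σ : ℝ} (hσ : σ = 1 ∨ σ = -1)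
    {c α m r : ℝ} (hα : α < m) (hr : 0 < r)
    (hreg : ∀ x, |x - c| < r → ∀ w ∈ Ioo α m, d.point x (σ * w) ∈ interior P.carrier)
    (hv : d.point c (σ * m) ∈ P.vertices) :
    ∃ s ∈ P.extendedEdges, s.dir ≠ d ∧ ∀ w ∈ Icc α m, d.point c (σ * w) ∈ s.toSet := by
  obtain ⟨e, he, f, hf, hed, hfd, hve, hvf, huniq⟩ := exists_edges_at_vertex hv d
  obtain ⟨hel, hec⟩ := (OrthoSegment.point_mem_endpoints hed).1 hve
  obtain ⟨hfl, hfc⟩ := (OrthoSegment.point_mem_endpoints_of_ne hfd).1 hvf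
  have hbelow : ∀ w ∈ Ioo α m, d.point c (σ * w) ∈ interior P.carrier :=
    hreg c (by simpa using hr)
  -- The perpendicular edge leaves the vertex on the upper side.
  have hfend : σ = 1 ∧ f.lo = m ∨ σ = -1 ∧ f.hi = -m := by
    obtain ⟨w, hw₁, hw₂⟩ := exists_between (max_lt hα (sub_lt_self m (sub_pos.2 f.lo_lt_hi)))
    have hwα := (le_max_left _ _).trans_lt hw₁
    have hwf := (le_max_right _ _).trans_lt hw₁
    have hnot : ¬ (σ * w ∈ Icc f.lo f.hi) := fun hmem =>
      notMem_frontier (hbelow w ⟨hwα, hw₂⟩)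
        (edge_subset_frontier hf ((OrthoSegment.point_mem_toSet_of_ne hfd).2 ⟨hfl, hmem⟩))
    rcases hσ with rfl | rfl <;> rcases hfc with h | h
    · exact Or.inl ⟨rfl, by linarith⟩
    · exact absurd ⟨by linarith, by linarith⟩ hnot
    · exact absurd ⟨by linarith, by linarith⟩ hnot
    · exact Or.inr ⟨rfl, by linarith⟩
  -- `τ` is the direction in which the edge `e` leaves the vertex.
  obtain ⟨τ, hτ, heτ⟩ : ∃ τ : ℝ, (τ = 1 ∨ τ = -1) ∧ (τ = 1 ∧ c = e.lo ∨ τ = -1 ∧ c = e.hi) := by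
    rcases hec with h | h
    · exact ⟨1, Or.inl rfl, Or.inl ⟨rfl, h⟩⟩
    · exact ⟨-1, Or.inr rfl, Or.inr ⟨rfl, h⟩⟩
  have hlow : ∀ x ∈ Ioo 0 r, ∀ y ∈ Ioo 0 (m - α), ∀ a : ℝ, (a = 1 ∨ a = -1) →
      d.point (c + a * x) (σ * m + -σ * y) ∈ interior P.carrier := by
    intro x hx y hy a ha
    have := hreg (c + a * x) (by rcases ha with rfl | rfl <;> simp [abs_of_pos hx.1, hx.2])
      (m - y) ⟨by linarith [hy.2], by linarith [hy.1]⟩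
    convert this using 2
    ring
  have hreflex : P.IsReflexVertex (d.point c (σ * m)) := by
    refine isReflexVertex_of_quadrants d hτ hσ hv ?_ ?_ ?_
    -- If the upper quadrant on the side of `e` were occupied, `e` would have the polygon on both
    -- sides.
    · rw [occupiesQuadrant_point]
      rintro ⟨ε, hε, hocc⟩
      obtain ⟨x, hx₀, hx₁⟩ := exists_between
        (lt_min (lt_min hε hr) (sub_pos.2 e.lo_lt_hi))
      simp only [lt_min_iff] at hx₁
      have hsides : ∀ σ' : ℝ, (σ' = σ ∨ σ' = -σ) → ∀ ε' > 0, ∃ δ ∈ Ioo 0 ε',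
          e.dir.point (c + τ * x) (e.level + σ' * δ) ∈ P.carrier := by
        rw [hed, ← hel]
        rintro σ' (rfl | rfl) ε' hε'
        · obtain ⟨y, hy₀, hy₁⟩ := exists_between (lt_min hε' hε)
          rw [lt_min_iff] at hy₁
          exact ⟨y, ⟨hy₀, hy₁.1⟩, hocc x ⟨hx₀, hx₁.1.1⟩ y ⟨hy₀, hy₁.2⟩⟩
        · obtain ⟨y, hy₀, hy₁⟩ := exists_between (lt_min hε' (sub_pos.2 hα))
          rw [lt_min_iff] at hy₁
          exact ⟨y, ⟨hy₀, hy₁.1⟩,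
            interior_subset (hlow x ⟨hx₀, hx₁.1.2⟩ y ⟨hy₀, hy₁.2⟩ τ hτ)⟩
      refine not_both_sides (x₀ := c + τ * x) he ?_ fun σ' hσ' => hsides σ' ?_
      · rcases heτ with ⟨rfl, rfl⟩ | ⟨rfl, rfl⟩ <;> constructor <;> linarith
      · rcases hσ with rfl | rfl <;> rcases hσ' with rfl | rfl <;> simp
    -- No edge separates the other upper quadrant from the lower quadrant next to it.
    · rw [occupiesQuadrant_point]
      obtain ⟨ε, hε, hball⟩ := P.exists_ball_frontier (d.point c (σ * m))
      set ρ := min (min ε r) (m - α) with hρ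
      have hρ₀ : 0 < ρ := lt_min (lt_min hε hr) (sub_pos.2 hα)
      have hρε : ρ ≤ ε := (min_le_left _ _).trans (min_le_left _ _)
      have hρr : ρ ≤ r := (min_le_left _ _).trans (min_le_right _ _)
      have hρα : ρ ≤ m - α := min_le_right _ _
      have hpre : IsPreconnected ((fun z : ℝ × ℝ => d.point (c + -τ * z.1) (σ * m + σ * z.2)) ''
          (Ioo 0 ρ ×ˢ Ioo (-ρ) ρ)) :=
        (isPreconnected_Ioo.prod isPreconnected_Ioo).image _ (by fun_prop)
      have hsub := subset_interior_of_isPreconnected (P := P) hpre ?_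
        (q := d.point (c + -τ * (ρ / 2)) (σ * m + -σ * (ρ / 2)))
        ⟨(ρ / 2, -(ρ / 2)), ⟨⟨by positivity, by dsimp only; linarith⟩,
          ⟨by dsimp only; linarith, by dsimp only; linarith⟩⟩, by
            simp⟩
        (interior_subset (hlow _ ⟨by positivity, by linarith⟩ _ ⟨by positivity, by linarith⟩ (-τ)
          (by rcases hτ with rfl | rfl <;> simp)))
      · exact ⟨ρ, hρ₀, fun x hx y hy => interior_subset
          (hsub ⟨(x, y), ⟨hx, ⟨by linarith [hy.1], hy.2⟩⟩, rfl⟩)⟩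
      · rintro _ ⟨⟨x, y⟩, ⟨hx, hy⟩, rfl⟩ hfr
        have hx' : 0 < x ∧ x < ρ := hx
        have hy' : -ρ < y ∧ y < ρ := hy
        have hyρ : |y| < ε := (abs_lt.2 hy').trans_le hρε
        obtain ⟨g, hg, hvg, hgm⟩ := hball _ (by
          rw [d.mem_ball_iff]
          rcases hτ with rfl | rfl <;> rcases hσ with rfl | rfl <;>
            simp [abs_of_pos hx'.1, hx'.2.trans_le hρε, hyρ]) hfr
        rcases huniq g hg hvg with rfl | rfl
        · have := ((OrthoSegment.point_mem_toSet hed).1 hgm).2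
          dsimp only at this
          rcases heτ with ⟨rfl, rfl⟩ | ⟨rfl, rfl⟩
          · linarith [this.1]
          · linarith [this.2]
        · have := ((OrthoSegment.point_mem_toSet_of_ne hfd).1 hgm).1
          rw [← hfl] at this
          dsimp only at this
          rcases hτ with rfl | rfl <;> linarith
    · intro a ha
      rw [occupiesQuadrant_point]
      refine ⟨min r (m - α), lt_min hr (sub_pos.2 hα), fun x hx y hy => interior_subset ?_⟩
      exact hlow x ⟨hx.1, hx.2.trans_le (min_le_left _ _)⟩ y
        ⟨hy.1, hy.2.trans_le (min_le_right _ _)⟩ a ha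
  obtain ⟨s, hs⟩ := exists_isExtendedEdge hf
  have hpt : ∀ u, f.pt u = d.point c u := fun u => by
    rw [OrthoSegment.pt_eq_point, ← hfl, Orientation2.point_of_ne hfd]
  have hsd : s.dir ≠ d := by rwa [hs.1]
  refine ⟨s, ⟨f, hf, hs⟩, hsd, fun w hw => ?_⟩
  rw [OrthoSegment.point_mem_toSet_of_ne hsd]
  refine ⟨by rw [hs.2.1, hfl], ?_⟩
  rcases hfend with ⟨rfl, hm⟩ | ⟨rfl, hm⟩
  · obtain ⟨h₁, h₂, -⟩ := hs.2.2.1 (by rw [hpt, hm]; simpa using hreflex)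
    have : s.lo ≤ α := by
      by_contra! hlt
      refine notMem_frontier (hbelow s.lo ⟨hlt, by linarith⟩) ?_
      rw [hpt] at h₂
      simpa using h₂
    exact ⟨by linarith [hw.1], by linarith [hw.2, hs.le_hi, f.lo_lt_hi]⟩
  · obtain ⟨h₁, h₂, -⟩ := hs.2.2.2.2.1 (by rw [hpt, hm]; simpa using hreflex)
    have : -α ≤ s.hi := by
      by_contra! hlt
      refine notMem_frontier (hbelow (-s.hi) ⟨by linarith, by linarith⟩) ?_
      rw [hpt] at h₂
      simpa using h₂
    exact ⟨by linarith [hw.2, hs.lo_le, f.lo_lt_hi], by linarith [hw.1]⟩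

/-- A coordinate along `d` that is not the level of an edge perpendicular to `d`. -/
def GenericParam (P : OrthogonalPolygon) (d : Orientation2) (t : ℝ) : Prop :=
  ∀ e ∈ P.edges, e.dir ≠ d → e.level ≠ t

/-- The key dichotomy. Above an open rectangle in the interior whose upper side meets the boundary,
either the whole upper side is in the relative interior of one edge, or some extended edge crosses
the rectangle from top to bottom. -/
lemma exists_crossing_or_edge (d : Orientation2) {σ : ℝ} (hσ : σ = 1 ∨ σ = -1) {α m t t' x₀ : ℝ}
    (hα : α < m) (ht : P.GenericParam d t) (ht' : P.GenericParam d t')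
    (hreg : ∀ x ∈ uIcc t t', ∀ w ∈ Ioo α m, d.point x (σ * w) ∈ interior P.carrier)
    (hx₀ : x₀ ∈ uIcc t t') (hfr : d.point x₀ (σ * m) ∈ frontier P.carrier) :
    (∃ c ∈ uIcc t t', ∃ s ∈ P.extendedEdges, s.dir ≠ d ∧
      ∀ w ∈ Icc α m, d.point c (σ * w) ∈ s.toSet) ∨
    ∃ g ∈ P.edges, g.dir = d ∧ g.level = σ * m ∧ uIcc t t' ⊆ Ioo g.lo g.hi := by
  by_cases hvert : ∃ c ∈ uIcc t t', d.point c (σ * m) ∈ P.vertices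
  -- A vertex on the upper side cannot be at its ends, whose parameters are generic.
  · left
    obtain ⟨c, hc, hv⟩ := hvert
    obtain ⟨-, -, f, hf, -, hfd, -, hvf, -⟩ := exists_edges_at_vertex hv d
    have hfl := ((OrthoSegment.point_mem_endpoints_of_ne hfd).1 hvf).1
    have hct : c ≠ t := fun h => ht f hf hfd (by rw [← hfl, h])
    have hct' : c ≠ t' := fun h => ht' f hf hfd (by rw [← hfl, h])
    have h₁ : min t t' < c := lt_of_le_of_ne hc.1 (by
      rcases min_choice t t' with h | h <;> rw [h] <;> exact Ne.symm ‹_›)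
    have h₂ : c < max t t' := lt_of_le_of_ne hc.2 (by
      rcases max_choice t t' with h | h <;> rw [h] <;> assumption)
    refine ⟨c, hc, exists_extendedEdge_of_vertex d hσ hα
      (lt_min (sub_pos.2 h₁) (sub_pos.2 h₂)) (fun x hx => hreg x ?_) hv⟩
    rw [lt_min_iff, abs_lt, abs_lt] at hx
    exact ⟨by linarith [hx.1.1], by linarith [hx.2.2]⟩
  · right
    push Not at hvert
    obtain ⟨g, hg, hmem⟩ := mem_frontier_iff.1 hfr
    by_cases hgd : g.dir = d
    · obtain ⟨hgl, hgx⟩ := (OrthoSegment.point_mem_toSet hgd).1 hmem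
      refine ⟨g, hg, hgd, hgl.symm, fun x hx => ?_⟩
      have hnot : ∀ c, (c = g.lo ∨ c = g.hi) → c ∉ uIcc t t' := fun c hc hcm =>
        hvert c hcm (mem_vertices hg ((OrthoSegment.point_mem_endpoints hgd).2 ⟨hgl, hc⟩))
      have hoc : uIcc x₀ x ⊆ uIcc t t' := ordConnected_uIcc.uIcc_subset hx₀ hx
      constructor
      · by_contra! hle
        exact hnot _ (Or.inl rfl) (hoc ⟨(min_le_right _ _).trans hle,
          hgx.1.trans (le_max_left _ _)⟩)
      · by_contra! hle
        exact hnot _ (Or.inr rfl) (hoc ⟨(min_le_left _ _).trans hgx.2,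
          hle.trans (le_max_right _ _)⟩)
    · exfalso
      obtain ⟨hgl, hgx⟩ := (OrthoSegment.point_mem_toSet_of_ne hgd).1 hmem
      have hnv : ¬ (σ * m = g.lo ∨ σ * m = g.hi) := fun h => hvert x₀ hx₀
        (mem_vertices hg ((OrthoSegment.point_mem_endpoints_of_ne hgd).2 ⟨hgl, h⟩))
      push Not at hnv
      have h₁ := lt_of_le_of_ne hgx.1 hnv.1.symm
      have h₂ := lt_of_le_of_ne hgx.2 hnv.2
      have hlt : max α (max (m - (σ * m - g.lo)) (m - (g.hi - σ * m))) < m :=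
        max_lt hα (max_lt (by linarith) (by linarith))
      obtain ⟨w, hw₁, hw₂⟩ := exists_between hlt
      simp only [max_lt_iff] at hw₁
      refine notMem_frontier (hreg x₀ hx₀ w ⟨hw₁.1, hw₂⟩) (edge_subset_frontier hg
        ((OrthoSegment.point_mem_toSet_of_ne hgd).2 ⟨hgl, ?_⟩))
      rcases hσ with rfl | rfl <;> constructor <;> linarith

/-! ### Generic points and the pieces their chords land on -/

/-- An interior point whose horizontal and vertical lines carry no edge. -/
def Generic (P : OrthogonalPolygon) (p : ℝ × ℝ) : Prop :=
  p ∈ interior P.carrier ∧ ∀ d : Orientation2, P.GenericParam d (d.along p)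

/-- The chord of the polygon that starts at `p` perpendicularly to the piece `b` (downward if `b` is
horizontal, to the right if `b` is vertical) ends on the piece `b`. Heights `w` above `b` are
measured by the coordinate perpendicular to `b`, with the sign that makes the polygon lie above
`b`. -/
def Lands (P : OrthogonalPolygon) (p : ℝ × ℝ) (b : OrthoSegment) : Prop :=
  b ∈ P.boundaryPieces ∧ b.dir.along p ∈ Ioo b.lo b.hi ∧
    b.dir.sgn * b.level < b.dir.sgn * b.dir.across p ∧
    ∀ w ∈ Ioc (b.dir.sgn * b.level) (b.dir.sgn * b.dir.across p),
      b.dir.point (b.dir.along p) (b.dir.sgn * w) ∈ interior P.carrier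

lemma isRightOrBottom_iff {e : OrthoSegment} : P.IsRightOrBottom e ↔
    ∀ t ∈ Ioo e.lo e.hi, ∀ᶠ δ : ℝ in 𝓝[>] 0,
      e.dir.point t (e.level + e.dir.sgn * δ) ∈ P.carrier := by
  unfold IsRightOrBottom
  cases e.dir <;> simp [Orientation2.point, Orientation2.sgn, sub_eq_add_neg]

lemma exists_mem_Ioo_of_eventually {p : ℝ → Prop} (h : ∀ᶠ δ : ℝ in 𝓝[>] 0, p δ) :
    ∀ ε > 0, ∃ δ ∈ Ioo 0 ε, p δ := fun _ hε =>
  let ⟨δ, h₁, h₂⟩ := (h.and (Ioo_mem_nhdsGT hε)).exists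
  ⟨δ, h₂, h₁⟩

lemma IsCutPoint.exists_edge {e : OrthoSegment} {t : ℝ} (h : P.IsCutPoint e (e.pt t)) :
    ∃ f ∈ P.edges, f.dir ≠ e.dir ∧ f.level = t := by
  obtain ⟨s, ⟨f, hf, hs⟩, hd, hmem⟩ := h
  rw [OrthoSegment.pt_eq_point, OrthoSegment.point_mem_toSet_of_ne hd] at hmem
  exact ⟨f, hf, hs.1 ▸ hd, by rw [← hs.2.1, hmem.1]⟩

lemma isCutPoint_of_mem_endpoints {e : OrthoSegment} (he : e ∈ P.edges) {v : ℝ × ℝ}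
    (hv : v ∈ e.endpoints) : P.IsCutPoint e v := by
  obtain ⟨f, hf, hfd, hvf, -⟩ := P.exists_perpendicular e he v hv
  obtain ⟨s, hs⟩ := exists_isExtendedEdge hf
  exact ⟨s, ⟨f, hf, hs⟩, hs.1 ▸ hfd, hs.subset (f.endpoints_subset_toSet hvf)⟩

/-- A generic point of a right or bottom edge lies in the interior of a piece. -/
lemma exists_piece {e : OrthoSegment} (he : e ∈ P.edges) (hside : P.IsRightOrBottom e) {t : ℝ}
    (ht : t ∈ Ioo e.lo e.hi) (hgen : P.GenericParam e.dir t) :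
    ∃ b ∈ P.boundaryPieces, b.dir = e.dir ∧ b.level = e.level ∧ t ∈ Ioo b.lo b.hi := by
  set D : Set ℝ := {x | P.IsCutPoint e (e.pt x)} with hD
  have hfin : D.Finite := by
    refine (P.edges.finite_toSet.image OrthoSegment.level).subset fun x hx => ?_
    obtain ⟨f, hf, -, hfl⟩ := IsCutPoint.exists_edge hx
    exact ⟨f, hf, hfl⟩
  have htD : t ∉ D := fun h => by
    obtain ⟨f, hf, hfd, hfl⟩ := IsCutPoint.exists_edge h
    exact hgen f hf hfd hfl
  have hlo : e.lo ∈ D := isCutPoint_of_mem_endpoints he (Or.inl rfl)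
  have hhi : e.hi ∈ D := isCutPoint_of_mem_endpoints he (Or.inr rfl)
  obtain ⟨l, hl, hlmax⟩ := Set.exists_max_image (D ∩ Iio t) id (hfin.inter_of_left _)
    ⟨e.lo, hlo, ht.1⟩
  obtain ⟨u, hu, humin⟩ := Set.exists_min_image (D ∩ Ioi t) id (hfin.inter_of_left _)
    ⟨e.hi, hhi, ht.2⟩
  have hl2 : l < t := hl.2
  have hu2 : t < u := hu.2
  refine ⟨⟨e.dir, e.level, l, u, hl2.trans hu2⟩, ⟨e, he, hside, rfl, rfl, ?_, ?_, hl.1, hu.1, ?_⟩,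
    rfl, rfl, hl2, hu2⟩
  · exact hlmax e.lo ⟨hlo, ht.1⟩
  · exact humin e.hi ⟨hhi, ht.2⟩
  · intro x hx hcut
    have hx1 : l < x := hx.1
    have hx2 : x < u := hx.2
    rcases lt_trichotomy x t with h | h | h
    · exact hx1.not_ge (hlmax x ⟨hcut, h⟩)
    · exact htD (h ▸ hcut)
    · exact hx2.not_ge (humin x ⟨hcut, h⟩)

/-- A boundary point whose perpendicular line is generic lies in the relative interior of an
edge. -/
lemma exists_edge_of_genericParam {d : Orientation2} {t u : ℝ} (ht : P.GenericParam d t)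
    (hfr : d.point t u ∈ frontier P.carrier) :
    ∃ e ∈ P.edges, e.dir = d ∧ e.level = u ∧ t ∈ Ioo e.lo e.hi := by
  obtain ⟨e, he, hmem⟩ := mem_frontier_iff.1 hfr
  by_cases hed : e.dir = d
  · obtain ⟨hel, hx⟩ := (OrthoSegment.point_mem_toSet hed).1 hmem
    have hnot : ¬ (t = e.lo ∨ t = e.hi) := by
      intro h
      obtain ⟨-, -, f, hf, -, hfd, -, hvf, -⟩ := exists_edges_at_vertex
        (mem_vertices he ((OrthoSegment.point_mem_endpoints hed).2 ⟨hel, h⟩)) d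
      exact ht f hf hfd ((OrthoSegment.point_mem_endpoints_of_ne hfd).1 hvf).1.symm
    push Not at hnot
    exact ⟨e, he, hed, hel.symm, lt_of_le_of_ne hx.1 hnot.1.symm, lt_of_le_of_ne hx.2 hnot.2⟩
  · exact absurd ((OrthoSegment.point_mem_toSet_of_ne hed).1 hmem).1.symm (ht e he hed)

lemma exists_lands {p : ℝ × ℝ} (hp : P.Generic p) (d : Orientation2) :
    ∃ b, b.dir = d ∧ P.Lands p b := by
  obtain ⟨d', hd'⟩ := d.exists_ne
  have hint : d'.point (d.across p) (d.along p) ∈ interior P.carrier := by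
    rw [← Orientation2.point_of_ne hd'.symm, d.point_along_across]
    exact hp.1
  have hneg : -d.sgn = 1 ∨ -d.sgn = -1 := by
    rcases d.sgn_eq with h | h <;> simp [h]
  obtain ⟨l, hl, hfr, hchord⟩ := exists_first_hit d' hneg hint
  rw [← Orientation2.point_of_ne hd'.symm] at hfr
  obtain ⟨e, he, hed, hel, hx⟩ := exists_edge_of_genericParam (hp.2 d) hfr
  have hchord' : ∀ w ∈ Ioc (d.sgn * e.level) (d.sgn * d.across p),
      d.point (d.along p) (d.sgn * w) ∈ interior P.carrier := by
    intro w hw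
    have hs : d.sgn * (d.across p + -d.sgn * l) = d.sgn * d.across p - l := by
      rw [mul_add, neg_mul, mul_neg, d.sgn_mul_sgn_mul]
      ring
    rw [hel, hs] at hw
    have := hchord (d.sgn * d.across p - w) ⟨by linarith [hw.2], by linarith [hw.1]⟩
    rw [← Orientation2.point_of_ne hd'.symm] at this
    convert this using 2
    rw [neg_mul, mul_sub, d.sgn_mul_sgn_mul]
    ring
  have hlt : d.sgn * e.level < d.sgn * d.across p := by
    rw [hel, mul_add, neg_mul, mul_neg, d.sgn_mul_sgn_mul]
    linarith
  subst hed
  have hside : P.IsRightOrBottom e := by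
    rw [isRightOrBottom_iff]
    intro t ht
    obtain ⟨ε, hε, h⟩ := exists_side_subset_interior he e.dir.sgn_eq hx (fun ε hε => by
      obtain ⟨δ, hδ₀, hδ₁⟩ := exists_between (lt_min hε (sub_pos.2 hlt))
      rw [lt_min_iff] at hδ₁
      refine ⟨δ, ⟨hδ₀, hδ₁.1⟩, interior_subset ?_⟩
      have := hchord' (e.dir.sgn * e.level + δ) ⟨by linarith, by linarith⟩
      rwa [mul_add, e.dir.sgn_mul_sgn_mul] at this) ht.1 ht.2
    filter_upwards [Ioo_mem_nhdsGT hε] with δ hδ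
    exact interior_subset (h t ⟨le_rfl, le_rfl⟩ δ hδ)
  obtain ⟨b, hb, hbd, hbl, hbt⟩ := exists_piece he hside hx (hp.2 _)
  refine ⟨b, hbd, hb, ?_, ?_, ?_⟩
  · rwa [hbd]
  · rwa [hbd, hbl]
  · rwa [hbd, hbl]

/-- The edge that carries a piece, with the facts about pieces used below. -/
lemma exists_edge_of_mem_boundaryPieces {b : OrthoSegment} (hb : b ∈ P.boundaryPieces) :
    ∃ e ∈ P.edges, b.dir = e.dir ∧ b.level = e.level ∧ e.lo ≤ b.lo ∧ b.hi ≤ e.hi ∧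
      (∀ t ∈ Ioo e.lo e.hi, ∀ ε > 0, ∃ δ ∈ Ioo 0 ε,
        e.dir.point t (e.level + e.dir.sgn * δ) ∈ P.carrier) ∧
      P.IsCutPoint e (e.pt b.lo) ∧ P.IsCutPoint e (e.pt b.hi) ∧
      ∀ t ∈ Ioo b.lo b.hi, ¬ P.IsCutPoint e (e.pt t) := by
  obtain ⟨e, he, hside, h₁, h₂, h₃, h₄, h₅⟩ := hb
  rw [isRightOrBottom_iff] at hside
  exact ⟨e, he, h₁, h₂, h₃, h₄, fun t ht => exists_mem_Ioo_of_eventually (hside t ht), h₅⟩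

lemma subset_frontier_of_mem_boundaryPieces {b : OrthoSegment} (hb : b ∈ P.boundaryPieces) :
    b.toSet ⊆ frontier P.carrier := by
  obtain ⟨e, he, h₁, h₂, h₃, h₄, -⟩ := exists_edge_of_mem_boundaryPieces hb
  intro p hp
  rw [OrthoSegment.mem_toSet, h₁, h₂] at hp
  exact edge_subset_frontier he (e.mem_toSet.2 ⟨hp.1, h₃.trans hp.2.1, hp.2.2.trans h₄⟩)

/-- Two pieces on one line that share a generic point coincide. -/
lemma piece_eq {b b' : OrthoSegment} (hb : b ∈ P.boundaryPieces) (hb' : b' ∈ P.boundaryPieces)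
    (hd : b.dir = b'.dir) (hl : b.level = b'.level) {t : ℝ} (ht : t ∈ Ioo b.lo b.hi)
    (ht' : t ∈ Ioo b'.lo b'.hi) : b = b' := by
  obtain ⟨e, he, h₁, h₂, h₃, h₄, -, h₅, h₆, h₇⟩ := exists_edge_of_mem_boundaryPieces hb
  obtain ⟨e', he', k₁, k₂, k₃, k₄, -, k₅, k₆, k₇⟩ := exists_edge_of_mem_boundaryPieces hb'
  have hee : e' = e := by
    refine eq_of_mem_Ioo he he' (t := t) ⟨h₃.trans_lt ht.1, ht.2.trans_le h₄⟩ ?_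
    rw [OrthoSegment.point_mem_toSet (by rw [← k₁, ← hd, h₁]), ← k₂, ← hl, h₂]
    exact ⟨rfl, k₃.trans ht'.1.le, ht'.2.le.trans k₄⟩
  subst hee
  have hlo : b.lo = b'.lo := by
    rcases lt_trichotomy b.lo b'.lo with h | h | h
    · exact absurd k₅ (h₇ _ ⟨h, ht'.1.trans ht.2⟩)
    · exact h
    · exact absurd h₅ (k₇ _ ⟨h, ht.1.trans ht'.2⟩)
  have hhi : b.hi = b'.hi := by
    rcases lt_trichotomy b.hi b'.hi with h | h | h
    · exact absurd h₆ (k₇ _ ⟨ht'.1.trans ht.2, h⟩)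
    · exact h
    · exact absurd k₆ (h₇ _ ⟨ht.1.trans ht'.2, h⟩)
  cases b
  cases b'
  simp_all

/-- A generic parameter of a piece lies in the open parameter interval. -/
lemma mem_Ioo_of_genericParam {b : OrthoSegment} (hb : b ∈ P.boundaryPieces) {t : ℝ}
    (ht : t ∈ Icc b.lo b.hi) (hgen : P.GenericParam b.dir t) : t ∈ Ioo b.lo b.hi := by
  obtain ⟨e, he, h₁, -, -, -, -, h₅, h₆, -⟩ := exists_edge_of_mem_boundaryPieces hb
  constructor
  · refine lt_of_le_of_ne ht.1 fun h => ?_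
    obtain ⟨f, hf, hfd, hfl⟩ := h₅.exists_edge
    exact hgen f hf (h₁ ▸ hfd) (hfl.trans h)
  · refine lt_of_le_of_ne ht.2 fun h => ?_
    obtain ⟨f, hf, hfd, hfl⟩ := h₆.exists_edge
    exact hgen f hf (h₁ ▸ hfd) (hfl.trans h.symm)

/-- Immediately below a piece there is no point of the polygon. -/
lemma piece_below {b : OrthoSegment} (hb : b ∈ P.boundaryPieces) {t : ℝ} (ht : t ∈ Ioo b.lo b.hi)
    {ε : ℝ} (hε : 0 < ε) :
    ∃ δ ∈ Ioo 0 ε, b.dir.point t (b.level - b.dir.sgn * δ) ∉ P.carrier := by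
  obtain ⟨e, he, h₁, h₂, h₃, h₄, hside, -⟩ := exists_edge_of_mem_boundaryPieces hb
  by_contra! hall
  have hte : t ∈ Ioo e.lo e.hi := ⟨h₃.trans_lt ht.1, ht.2.trans_le h₄⟩
  rw [h₁, h₂] at hall
  have hbelow : ∀ ε' > 0, ∃ δ ∈ Ioo 0 ε', e.dir.point t (e.level + -e.dir.sgn * δ) ∈ P.carrier := by
    intro ε' hε'
    obtain ⟨δ, h₀, h₁⟩ := exists_between (lt_min hε hε')
    rw [lt_min_iff] at h₁
    refine ⟨δ, ⟨h₀, h₁.2⟩, ?_⟩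
    have := hall δ ⟨h₀, h₁.1⟩
    rwa [neg_mul, ← sub_eq_add_neg]
  refine not_both_sides he hte fun σ hσ => ?_
  have : σ = e.dir.sgn ∨ σ = -e.dir.sgn := by
    rcases hσ with rfl | rfl <;> rcases e.dir.sgn_eq with h | h <;> simp [h]
  rcases this with rfl | rfl
  exacts [hside t hte, hbelow]

/-! ### Visibility -/

lemma sees_iff {s : OrthoSegment} {p : ℝ × ℝ} : P.Sees s p ↔
    s.dir.along p ∈ Icc s.lo s.hi ∧
      ∀ x ∈ uIcc s.level (s.dir.across p), s.dir.point (s.dir.along p) x ∈ P.carrier := by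
  constructor
  · rintro ⟨q, hq, hpar, hseg⟩
    rw [OrthoSegment.param_eq_along, OrthoSegment.param_eq_along] at hpar
    rw [OrthoSegment.mem_toSet, hpar] at hq
    rw [← s.dir.point_along_across q, ← s.dir.point_along_across p, hpar, hq.1,
      Orientation2.segment_point] at hseg
    exact ⟨hq.2, fun x hx => hseg ⟨x, hx, rfl⟩⟩
  · rintro ⟨h₁, h₂⟩
    refine ⟨s.dir.point (s.dir.along p) s.level, (OrthoSegment.point_mem_toSet rfl).2 ⟨rfl, h₁⟩,
      by simp [OrthoSegment.param_eq_along], ?_⟩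
    nth_rw 2 [← s.dir.point_along_across p]
    rw [Orientation2.segment_point]
    rintro _ ⟨x, hx, rfl⟩
    exact h₂ x hx

lemma isClosed_sees (P : OrthogonalPolygon) (s : OrthoSegment) : IsClosed {p | P.Sees s p} := by
  have : {p | P.Sees s p} = s.dir.along ⁻¹' Icc s.lo s.hi ∩ ⋂ r ∈ Icc (0 : ℝ) 1,
      (fun p => s.dir.point (s.dir.along p) (s.level + r * (s.dir.across p - s.level))) ⁻¹'
        P.carrier := by
    ext p
    simp only [Set.mem_ofPred_eq, sees_iff, mem_inter_iff, mem_preimage, mem_iInter]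
    refine and_congr_right fun _ => ?_
    rw [← segment_eq_uIcc, segment_eq_image']
    simp only [forall_mem_image, smul_eq_mul]
  rw [this]
  refine (isClosed_Icc.preimage (by fun_prop)).inter (isClosed_biInter fun r _ => ?_)
  exact P.isClosed_carrier.preimage (by fun_prop)

/-- The chord from `p` to `b` is contained in the polygon, including its foot on `b`. -/
lemma Lands.mem_carrier {p : ℝ × ℝ} {b : OrthoSegment} (h : P.Lands p b) {w : ℝ}
    (hw : w ∈ Icc (b.dir.sgn * b.level) (b.dir.sgn * b.dir.across p)) :
    b.dir.point (b.dir.along p) (b.dir.sgn * w) ∈ P.carrier := by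
  rcases hw.1.eq_or_lt with h' | h'
  · rw [← h', b.dir.sgn_mul_sgn_mul]
    exact P.frontier_subset (subset_frontier_of_mem_boundaryPieces h.1
      ((OrthoSegment.point_mem_toSet rfl).2 ⟨rfl, Ioo_subset_Icc_self h.2.1⟩))
  · exact interior_subset (h.2.2.2 w ⟨h', hw.2⟩)

lemma Lands.sees {p : ℝ × ℝ} {b : OrthoSegment} (h : P.Lands p b) : P.Sees b p := by
  rw [sees_iff]
  refine ⟨Ioo_subset_Icc_self h.2.1, fun x hx => ?_⟩
  have := b.dir.sgn_mul_mem_uIcc hx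
  rw [uIcc_of_le h.2.2.1.le] at this
  simpa [b.dir.sgn_mul_sgn_mul] using h.mem_carrier this

/-- A camera parallel to the piece `b` sees a generic point only from a position on the chord
through the point; hence it sees the foot of the chord. -/
lemma Lands.sees_foot {p : ℝ × ℝ} {b s : OrthoSegment} (h : P.Lands p b)
    (hd : s.dir = b.dir) (hs : P.Sees s p) :
    P.Sees s (b.dir.point (b.dir.along p) b.level) ∧
      b.dir.sgn * b.level ≤ b.dir.sgn * s.level := by
  rw [sees_iff, hd] at hs
  rw [sees_iff, hd]
  simp only [Orientation2.along_point, Orientation2.across_point]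
  have hcar : ∀ w ∈ uIcc (b.dir.sgn * s.level) (b.dir.sgn * b.dir.across p),
      b.dir.point (b.dir.along p) (b.dir.sgn * w) ∈ P.carrier := by
    intro w hw
    refine hs.2 _ ?_
    simpa [b.dir.sgn_mul_sgn_mul] using b.dir.sgn_mul_mem_uIcc hw
  have hle : b.dir.sgn * b.level ≤ b.dir.sgn * s.level := by
    by_contra! hlt
    obtain ⟨δ, hδ, hnot⟩ := piece_below h.1 h.2.1 (sub_pos.2 hlt)
    have := hcar (b.dir.sgn * b.level - δ)
      (mem_uIcc.2 (Or.inl ⟨by linarith [hδ.2], by linarith [hδ.1, h.2.2.1]⟩))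
    rw [mul_sub, b.dir.sgn_mul_sgn_mul] at this
    exact hnot this
  refine ⟨⟨hs.1, fun x hx => ?_⟩, hle⟩
  have hx' := b.dir.sgn_mul_mem_uIcc hx
  rw [uIcc_of_ge hle] at hx'
  rw [← b.dir.sgn_mul_sgn_mul x]
  by_cases hxp : b.dir.sgn * x ≤ b.dir.sgn * b.dir.across p
  · exact h.mem_carrier ⟨hx'.1, hxp⟩
  · exact hcar _ (mem_uIcc.2 (Or.inr ⟨(not_le.1 hxp).le, hx'.2⟩))

/-- Parallel pieces joined by a perpendicular segment inside the polygon coincide, because the polygon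
has no points immediately below the upper one. -/
lemma piece_eq_of_carrier {b b' : OrthoSegment} (hb : b ∈ P.boundaryPieces)
    (hb' : b' ∈ P.boundaryPieces) (hd : b.dir = b'.dir) {t : ℝ} (ht : t ∈ Ioo b.lo b.hi)
    (ht' : t ∈ Ioo b'.lo b'.hi)
    (hcar : ∀ x ∈ uIcc b.level b'.level, b.dir.point t x ∈ P.carrier) : b = b' := by
  have hcar' : ∀ w ∈ uIcc (b.dir.sgn * b.level) (b.dir.sgn * b'.level),
      b.dir.point t (b.dir.sgn * w) ∈ P.carrier := fun w hw => hcar _ <| by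
    simpa [b.dir.sgn_mul_sgn_mul] using b.dir.sgn_mul_mem_uIcc hw
  rcases lt_trichotomy (b.dir.sgn * b.level) (b.dir.sgn * b'.level) with h | h | h
  · obtain ⟨δ, hδ, hnot⟩ := piece_below hb' ht' (sub_pos.2 h)
    rw [← hd] at hnot
    have := hcar' (b.dir.sgn * b'.level - δ)
      (mem_uIcc.2 (Or.inl ⟨by linarith [hδ.2], by linarith [hδ.1]⟩))
    rw [mul_sub, b.dir.sgn_mul_sgn_mul] at this
    exact absurd this hnot
  · refine piece_eq hb hb' hd ?_ ht ht'
    rw [← b.dir.sgn_mul_sgn_mul b.level, h, b.dir.sgn_mul_sgn_mul]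
  · obtain ⟨δ, hδ, hnot⟩ := piece_below hb ht (sub_pos.2 h)
    have := hcar' (b.dir.sgn * b.level - δ)
      (mem_uIcc.2 (Or.inr ⟨by linarith [hδ.2], by linarith [hδ.1]⟩))
    rw [mul_sub, b.dir.sgn_mul_sgn_mul] at this
    exact absurd this hnot

/-- The only pieces that see a generic point are those on which its two chords land. -/
lemma Lands.eq_of_sees {p : ℝ × ℝ} {b b' : OrthoSegment} (hp : P.Generic p) (h : P.Lands p b)
    (hb' : b' ∈ P.boundaryPieces) (hd : b'.dir = b.dir) (hs : P.Sees b' p) : b' = b := by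
  have hfoot := sees_iff.1 (h.sees_foot hd hs).1
  rw [hd] at hfoot
  simp only [Orientation2.along_point, Orientation2.across_point] at hfoot
  refine piece_eq_of_carrier hb' h.1 hd (t := b.dir.along p) ?_ h.2.1 (by rw [hd]; exact hfoot.2)
  exact mem_Ioo_of_genericParam hb' hfoot.1 (hd ▸ hp.2 _)

/-! ### Moving generic points -/

lemma isOpen_cutRegion (P : OrthogonalPolygon) : IsOpen P.cutRegion := by
  have : P.cutRegion = interior P.carrier \ ⋃ s ∈ P.extendedEdges, s.toSet := by
    ext p
    constructor
    · rintro ⟨h₁, h₂⟩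
      exact ⟨mem_interior_iff.2 ⟨h₁, fun h => h₂ (P.frontier_subset_extendedEdges h)⟩, h₂⟩
    · rintro ⟨h₁, h₂⟩
      exact ⟨interior_subset h₁, h₂⟩
  rw [this]
  exact isOpen_interior.sdiff
    (P.finite_extendedEdges.isClosed_biUnion fun s _ => s.isClosed_toSet)

lemma cutRegion_subset_interior (P : OrthogonalPolygon) :
    P.cutRegion ⊆ interior P.carrier := fun _ hp =>
  mem_interior_iff.2 ⟨hp.1, fun h => hp.2 (P.frontier_subset_extendedEdges h)⟩

lemma Generic.mem_cutRegion {p : ℝ × ℝ} (hp : P.Generic p) : p ∈ P.cutRegion := by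
  refine ⟨interior_subset hp.1, ?_⟩
  simp only [mem_iUnion, not_exists]
  rintro s ⟨e, he, hs⟩ hmem
  obtain ⟨d, hd⟩ := e.dir.exists_ne
  refine hp.2 d e he hd.symm ?_
  rw [Orientation2.along_of_ne hd, ← hs.1, ← hs.2.1, (s.mem_toSet.1 hmem).1]

lemma exists_generic {W : Set (ℝ × ℝ)} (hW : IsOpen W) (hne : W.Nonempty)
    (hsub : W ⊆ interior P.carrier) : ∃ p ∈ W, P.Generic p := by
  set L : Set ℝ := OrthoSegment.level '' (P.edges : Set OrthoSegment) with hL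
  have hdense : Dense Lᶜ := (P.edges.finite_toSet.image _).countable.dense_compl ℝ
  obtain ⟨p, hp, hpL⟩ := (hdense.prod hdense).inter_open_nonempty W hW hne
  refine ⟨p, hp, hsub hp, fun d e he _ hel => ?_⟩
  cases d
  exacts [hpL.1 ⟨e, he, hel⟩, hpL.2 ⟨e, he, hel⟩]

/-- Generic points are dense in the polygon. -/
lemma frequently_generic {z : ℝ × ℝ} (hz : z ∈ P.carrier) : ∃ᶠ p in 𝓝 z, P.Generic p := by
  rw [frequently_iff]
  intro U hU
  obtain ⟨W, hWU, hW, hzW⟩ := mem_nhds_iff.1 hU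
  rw [← P.closure_interior] at hz
  obtain ⟨q, hqW, hqI⟩ := mem_closure_iff.1 hz W hW hzW
  obtain ⟨p, hp, hgen⟩ := exists_generic (hW.inter isOpen_interior) ⟨q, hqW, hqI⟩
    inter_subset_right
  exact ⟨p, hWU hp.1, hgen⟩

lemma Lands.of_along_eq {p p' : ℝ × ℝ} {b : OrthoSegment} (h : P.Lands p b)
    (hal : b.dir.along p' = b.dir.along p)
    (hseg : ∀ x ∈ uIcc (b.dir.across p) (b.dir.across p'),
      b.dir.point (b.dir.along p) x ∈ interior P.carrier) : P.Lands p' b := by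
  have hseg' : ∀ w ∈ uIcc (b.dir.sgn * b.dir.across p) (b.dir.sgn * b.dir.across p'),
      b.dir.point (b.dir.along p) (b.dir.sgn * w) ∈ interior P.carrier := fun w hw => hseg _ <| by
    simpa [b.dir.sgn_mul_sgn_mul] using b.dir.sgn_mul_mem_uIcc hw
  have hlt : b.dir.sgn * b.level < b.dir.sgn * b.dir.across p' := by
    by_contra! hle
    have := hseg' (b.dir.sgn * b.level) (mem_uIcc.2 (Or.inr ⟨hle, h.2.2.1.le⟩))
    rw [b.dir.sgn_mul_sgn_mul] at this
    exact notMem_frontier this (subset_frontier_of_mem_boundaryPieces h.1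
      ((OrthoSegment.point_mem_toSet rfl).2 ⟨rfl, Ioo_subset_Icc_self h.2.1⟩))
  refine ⟨h.1, hal ▸ h.2.1, hlt, fun w hw => ?_⟩
  rw [hal]
  by_cases hwp : w ≤ b.dir.sgn * b.dir.across p
  · exact h.2.2.2 w ⟨hw.1, hwp⟩
  · exact hseg' w (mem_uIcc.2 (Or.inl ⟨(not_le.1 hwp).le, hw.2⟩))

lemma frontier_free_column {d : Orientation2} {x : ℝ} {σ : ℝ} {A : Set ℝ} (hA : IsPreconnected A)
    (hf : ∀ w ∈ A, d.point x (σ * w) ∉ frontier P.carrier) {w₀ : ℝ} (hw₀ : w₀ ∈ A)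
    (hmem : d.point x (σ * w₀) ∈ P.carrier) {w : ℝ} (hw : w ∈ A) :
    d.point x (σ * w) ∈ interior P.carrier := by
  refine subset_interior_of_isPreconnected (hA.image (fun w => d.point x (σ * w)) (by fun_prop))
    ?_ ⟨w₀, hw₀, rfl⟩ hmem ⟨w, hw, rfl⟩
  rintro _ ⟨y, hy, rfl⟩
  exact hf y hy

lemma isCompact_frontier_strip (P : OrthogonalPolygon) (d : Orientation2) (σ : ℝ) {A B : Set ℝ}
    (hA : IsClosed A) (hB : IsClosed B) :
    IsCompact {q | q ∈ frontier P.carrier ∧ d.along q ∈ A ∧ σ * d.across q ∈ B} := by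
  refine P.isCompact_carrier.of_isClosed_subset ?_ fun q hq => P.frontier_subset hq.1
  exact isClosed_frontier.inter ((hA.preimage (by fun_prop)).inter
    (hB.preimage (f := fun q => σ * d.across q) (by fun_prop)))

/-- Moving a generic point parallel to `b` without crossing the segments of `S(P)` does not change
the piece on which its chord lands. Sweep the segment of motion downward until it first meets the
boundary; an extended edge that reached it from below would be crossed by the motion. -/
lemma Lands.of_across_eq {p p' : ℝ × ℝ} {b : OrthoSegment} (h : P.Lands p b)
    (hgen : P.GenericParam b.dir (b.dir.along p)) (hgen' : P.GenericParam b.dir (b.dir.along p'))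
    (hac : b.dir.across p' = b.dir.across p)
    (hseg : ∀ x ∈ uIcc (b.dir.along p) (b.dir.along p'),
      b.dir.point x (b.dir.across p) ∈ P.cutRegion) : P.Lands p' b := by
  set d := b.dir with hd
  set σ := d.sgn with hσd
  set W := σ * d.across p with hW
  set t := d.along p with ht
  set t' := d.along p' with ht'
  have hσ : σ = 1 ∨ σ = -1 := d.sgn_eq
  have hσσ : ∀ x, σ * (σ * x) = x := d.sgn_mul_sgn_mul
  have hσW : σ * W = d.across p := hσσ _
  have htu : t ∈ uIcc t t' := left_mem_uIcc
  obtain ⟨q, ⟨hqf, hqx, hqW⟩, hqmax⟩ := (P.isCompact_frontier_strip d σ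
    (A := uIcc t t') (B := Iic W) isClosed_Icc isClosed_Iic).exists_isMaxOn
    ⟨d.point t b.level, subset_frontier_of_mem_boundaryPieces h.1
      ((OrthoSegment.point_mem_toSet rfl).2 ⟨rfl, Ioo_subset_Icc_self h.2.1⟩), by simp [htu],
      by simpa using h.2.2.1.le⟩ (f := fun q => σ * d.across q) (by fun_prop)
  set m := σ * d.across q with hm
  have hq : d.point (d.along q) (σ * m) = q := by rw [hm, hσσ, d.point_along_across]
  have hmW : m < W := by
    refine lt_of_le_of_ne hqW fun hmW => ?_
    have := P.cutRegion_subset_interior (hseg _ hqx)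
    rw [← hσW, ← hmW, hq] at this
    exact notMem_frontier this hqf
  have habove : ∀ x ∈ uIcc t t', ∀ w ∈ Ioc m W, d.point x (σ * w) ∈ interior P.carrier := by
    intro x hx w hw
    refine frontier_free_column isPreconnected_Ioc (fun y hy hfr => ?_) (w₀ := W)
      ⟨hmW, le_rfl⟩ ?_ hw
    · have hle := hqmax (a := d.point x (σ * y)) ⟨hfr, by simpa using hx, by simpa [hσσ] using hy.2⟩
      have hle' : σ * d.across (d.point x (σ * y)) ≤ m := hle
      rw [d.across_point, hσσ] at hle'
      exact hy.1.not_ge hle'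
    · rw [hσW]
      exact interior_subset (P.cutRegion_subset_interior (hseg x hx))
  have hneg : -σ = 1 ∨ -σ = -1 := by rcases hσ with h | h <;> simp [h]
  rcases exists_crossing_or_edge d hneg (neg_lt_neg hmW) hgen hgen'
    (fun x hx w hw => by
      have := habove x hx (-w) ⟨by linarith [hw.2], by linarith [hw.1]⟩
      rwa [mul_neg, ← neg_mul] at this) hqx (by rw [neg_mul_neg, hq]; exact hqf) with
    ⟨c, hc, s, hs, -, hcross⟩ | ⟨g, hg, hgd, hgl, hsub⟩
  · have := hcross (-W) ⟨le_rfl, (neg_lt_neg hmW).le⟩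
    rw [neg_mul_neg, hσW] at this
    exact absurd (mem_biUnion hs this) (hseg c hc).2
  · rw [neg_mul_neg] at hgl
    have hmb : m = σ * b.level := by
      refine le_antisymm ?_ ?_
      · by_contra! hlt
        refine notMem_frontier (h.2.2.2 m ⟨hlt, hqW⟩) (edge_subset_frontier hg
          ((OrthoSegment.point_mem_toSet hgd).2 ⟨hgl.symm, Ioo_subset_Icc_self (hsub htu)⟩))
      · have hle := hqmax (a := d.point t b.level) ⟨subset_frontier_of_mem_boundaryPieces h.1
          ((OrthoSegment.point_mem_toSet rfl).2 ⟨rfl, Ioo_subset_Icc_self h.2.1⟩),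
          by simp [htu], by simpa using h.2.2.1.le⟩
        have hle' : σ * d.across (d.point t b.level) ≤ m := hle
        rwa [d.across_point] at hle'
    have hgb : g.level = b.level := by rw [hgl, hmb, hσσ]
    have htb' : t' ∈ Ioo b.lo b.hi := by
      by_contra hnot
      obtain ⟨e, he, h₁, h₂, h₃, h₄, -, h₅, h₆, -⟩ := exists_edge_of_mem_boundaryPieces h.1
      have hge : e = g := eq_of_mem_Ioo hg he (hsub htu) <| by
        rw [hgd, OrthoSegment.point_mem_toSet h₁.symm, hgb]
        exact ⟨h₂, h₃.trans h.2.1.1.le, h.2.1.2.le.trans h₄⟩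
      subst hge
      obtain ⟨c, hc, hcut⟩ : ∃ c ∈ uIcc t t', P.IsCutPoint e (e.pt c) := by
        rw [mem_Ioo, not_and_or, not_lt, not_lt] at hnot
        rcases hnot with hnot | hnot
        · exact ⟨b.lo, mem_uIcc.2 (Or.inr ⟨hnot, h.2.1.1.le⟩), h₅⟩
        · exact ⟨b.hi, mem_uIcc.2 (Or.inl ⟨h.2.1.2.le, hnot⟩), h₆⟩
      obtain ⟨s, hs, hsd, hmem⟩ := hcut
      rw [hgd] at hsd
      rw [OrthoSegment.pt_eq_point, hgd, OrthoSegment.point_mem_toSet_of_ne hsd, hgb] at hmem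
      -- `top` and `bot` are the upper and lower ends of `s` with respect to the height.
      obtain ⟨top, bot, htop, hbt, hbl, hlt, hall⟩ : ∃ top bot : ℝ,
          d.point c top ∈ frontier P.carrier ∧ σ * bot < σ * top ∧ σ * bot ≤ m ∧ m ≤ σ * top ∧
          ∀ w ∈ Icc (σ * bot) (σ * top), d.point c (σ * w) ∈ s.toSet := by
        have hends := endpoints_subset_frontier hs
        simp only [OrthoSegment.pt_eq_point, ← hmem.1] at hends
        simp only [OrthoSegment.point_mem_toSet_of_ne hsd, hmb]
        rw [Orientation2.point_of_ne hsd, Orientation2.point_of_ne hsd] at hends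
        have := s.lo_lt_hi
        rcases hσ with hσ | hσ <;> rw [hσ]
        · exact ⟨s.hi, s.lo, hends.2, by linarith, by linarith [hmem.2.1], by linarith [hmem.2.2],
            fun w hw => ⟨hmem.1, by linarith [hw.1], by linarith [hw.2]⟩⟩
        · exact ⟨s.lo, s.hi, hends.1, by linarith, by linarith [hmem.2.2], by linarith [hmem.2.1],
            fun w hw => ⟨hmem.1, by linarith [hw.2], by linarith [hw.1]⟩⟩
      have hWtop : σ * top < W := by
        by_contra! hle
        have := hall W ⟨hbl.trans hmW.le, hle⟩
        rw [hσW] at this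
        exact (hseg c hc).2 (mem_biUnion hs this)
      have hmtop : m = σ * top := by
        refine hlt.eq_or_lt.resolve_right fun hlt => ?_
        have := habove c hc (σ * top) ⟨hlt, hWtop.le⟩
        rw [hσσ] at this
        exact notMem_frontier this htop
      -- Now `s` comes from below and `b` from above, so both sides of the edge are occupied.
      refine not_both_sides he (hsub hc) fun σ' hσ' ε hε => ?_
      rw [hgd, hgl]
      have : σ' = σ ∨ σ' = -σ := by
        rcases hσ with h | h <;> rcases hσ' with h' | h' <;> simp [h, h']
      rcases this with rfl | rfl
      · obtain ⟨δ, hδ₀, hδ₁⟩ := exists_between (lt_min hε (sub_pos.2 hmW))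
        rw [lt_min_iff] at hδ₁
        refine ⟨δ, ⟨hδ₀, hδ₁.1⟩, ?_⟩
        rw [← mul_add]
        exact interior_subset (habove c hc _ ⟨by linarith, by linarith⟩)
      · obtain ⟨δ, hδ₀, hδ₁⟩ := exists_between (lt_min hε (sub_pos.2 hbt))
        rw [lt_min_iff] at hδ₁
        refine ⟨δ, ⟨hδ₀, hδ₁.1⟩, ?_⟩
        rw [neg_mul, ← mul_neg, ← mul_add]
        exact extendedEdge_subset hs (hall _ ⟨by linarith, by linarith⟩)
    refine ⟨h.1, htb', by rw [hac]; exact h.2.2.1, fun w hw => ?_⟩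
    rw [hac, ← hd, ← hσd, ← hmb] at hw
    exact habove t' right_mem_uIcc w hw

/-- A generic point above a piece `b` can be moved parallel to `b` to any other generic position
above `b`, inside the polygon and with its chord still landing on `b`: a first obstacle met from
below would carry an extended edge that cuts `b`. -/
lemma Lands.of_mem_Ioo {p p' : ℝ × ℝ} {b : OrthoSegment} (h : P.Lands p b)
    (hgen : P.GenericParam b.dir (b.dir.along p)) (hgen' : P.GenericParam b.dir (b.dir.along p'))
    (hac : b.dir.across p' = b.dir.across p) (hb : b.dir.along p' ∈ Ioo b.lo b.hi) :
    P.Lands p' b ∧ ∀ x ∈ uIcc (b.dir.along p) (b.dir.along p'),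
      b.dir.point x (b.dir.across p) ∈ interior P.carrier := by
  set d := b.dir with hd
  set σ := d.sgn with hσd
  set W := σ * d.across p with hW
  set t := d.along p with ht
  set t' := d.along p' with ht'
  set β := σ * b.level with hβ
  have hσ : σ = 1 ∨ σ = -1 := d.sgn_eq
  have hσσ : ∀ x, σ * (σ * x) = x := d.sgn_mul_sgn_mul
  have hσW : σ * W = d.across p := hσσ _
  have hβW : β < W := h.2.2.1
  have htu : t ∈ uIcc t t' := left_mem_uIcc
  have hub : uIcc t t' ⊆ Ioo b.lo b.hi := ordConnected_Ioo.uIcc_subset h.2.1 hb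
  obtain ⟨e, he, h₁, h₂, h₃, h₄, hside, -, -, hcut⟩ := exists_edge_of_mem_boundaryPieces h.1
  obtain ⟨ε, hε, htube⟩ := exists_side_subset_interior he e.dir.sgn_eq
    ⟨h₃.trans_lt h.2.1.1, h.2.1.2.trans_le h₄⟩
    (hside t ⟨h₃.trans_lt h.2.1.1, h.2.1.2.trans_le h₄⟩)
    (h₃.trans_lt (lt_min h.2.1.1 hb.1)) ((max_lt h.2.1.2 hb.2).trans_le h₄)
  have htube' : ∀ x ∈ uIcc t t', ∀ w ∈ Ioo β (β + ε), d.point x (σ * w) ∈ interior P.carrier := by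
    intro x hx w hw
    have := htube x hx (w - β) ⟨by linarith [hw.1], by linarith [hw.2]⟩
    rw [← h₁, ← hd, ← hσd, ← h₂, mul_sub, hβ, hσσ] at this
    convert this using 2
    ring
  have hfree : ∀ x ∈ uIcc t t', ∀ w ∈ Icc (β + ε) W, d.point x (σ * w) ∉ frontier P.carrier := by
    by_contra! hex
    obtain ⟨x₁, hx₁, w₁, hw₁, hfr₁⟩ := hex
    obtain ⟨q, ⟨hqf, hqx, hqW⟩, hqmin⟩ := (P.isCompact_frontier_strip d σ
      (A := uIcc t t') (B := Icc (β + ε) W) isClosed_Icc isClosed_Icc).exists_isMinOn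
      ⟨d.point x₁ (σ * w₁), hfr₁, by simpa using hx₁, by simpa [hσσ] using hw₁⟩
      (f := fun q => σ * d.across q) (by fun_prop)
    set m := σ * d.across q with hm
    have hq : d.point (d.along q) (σ * m) = q := by rw [hm, hσσ, d.point_along_across]
    have hβm : β < m := by linarith [hqW.1]
    have hbelow : ∀ x ∈ uIcc t t', ∀ w ∈ Ioo β m, d.point x (σ * w) ∈ interior P.carrier := by
      intro x hx w hw
      refine frontier_free_column isPreconnected_Ioo (fun y hy hfr => ?_) (w₀ := β + ε / 2)
        ⟨by linarith, by linarith [hqW.1]⟩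
        (interior_subset (htube' x hx _ ⟨by linarith, by linarith⟩)) hw
      rcases lt_or_ge y (β + ε) with hyε | hyε
      · exact notMem_frontier (htube' x hx y ⟨hy.1, hyε⟩) hfr
      · have hle : m ≤ σ * d.across (d.point x (σ * y)) := hqmin (a := d.point x (σ * y))
          ⟨hfr, by simpa using hx, by simpa [hσσ] using ⟨hyε, hy.2.le.trans hqW.2⟩⟩
        rw [d.across_point, hσσ] at hle
        exact hy.2.not_ge hle
    rcases exists_crossing_or_edge d hσ hβm hgen hgen' hbelow hqx (by rw [hq]; exact hqf) with
      ⟨c, hc, s, hs, hsd, hcross⟩ | ⟨g, hg, hgd, hgl, hsub⟩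
    · have := hcross β ⟨le_rfl, hβm.le⟩
      rw [hβ, hσσ] at this
      refine hcut c (hub hc) ⟨s, hs, by rwa [← h₁], ?_⟩
      rwa [OrthoSegment.pt_eq_point, ← h₁, ← h₂]
    · exact notMem_frontier (h.2.2.2 m ⟨hβm, hqW.2⟩) (edge_subset_frontier hg
        ((OrthoSegment.point_mem_toSet hgd).2 ⟨hgl.symm, Ioo_subset_Icc_self (hsub htu)⟩))
  have hall : ∀ x ∈ uIcc t t', ∀ w ∈ Ioc β W, d.point x (σ * w) ∈ interior P.carrier := by
    intro x hx w hw
    obtain ⟨w₀, hw₀, hw₀'⟩ := exists_between (lt_min (lt_add_of_pos_right β hε) hβW)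
    rw [lt_min_iff] at hw₀'
    refine frontier_free_column isPreconnected_Ioc (fun y hy hfr => ?_) (w₀ := w₀)
      ⟨hw₀, hw₀'.2.le⟩ (interior_subset (htube' x hx _ ⟨hw₀, hw₀'.1⟩)) hw
    rcases lt_or_ge y (β + ε) with hyε | hyε
    · exact notMem_frontier (htube' x hx y ⟨hy.1, hyε⟩) hfr
    · exact hfree x hx y ⟨hyε, hy.2⟩ hfr
  refine ⟨⟨h.1, hb, by rw [hac]; exact h.2.2.1, fun w hw => ?_⟩, fun x hx => ?_⟩
  · rw [hac] at hw
    exact hall t' right_mem_uIcc w hw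
  · rw [← hσW]
    exact hall x hx W ⟨hβW, le_rfl⟩

lemma Lands.exists_moved {p : ℝ × ℝ} {b b' : OrthoSegment} (hp : P.Generic p)
    (h : P.Lands p b) (h' : P.Lands p b') (hdir : b.dir ≠ b'.dir) {t : ℝ} (ht : t ∈ Ioo b.lo b.hi)
    (hgen : P.GenericParam b.dir t) :
    ∃ q, P.Generic q ∧ b.dir.along q = t ∧ b'.dir.along q = b'.dir.along p ∧
      P.Lands q b ∧ P.Lands q b' := by
  set q := b.dir.point t (b.dir.across p) with hq
  have hqal : b.dir.along q = t := b.dir.along_point _ _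
  have hqac : b.dir.across q = b.dir.across p := b.dir.across_point _ _
  have hal : ∀ z, b'.dir.along z = b.dir.across z := fun z => Orientation2.along_of_ne hdir.symm z
  have hac : ∀ z, b'.dir.across z = b.dir.along z := fun z =>
    (Orientation2.along_of_ne hdir z).symm
  have hqal' : b'.dir.along q = b'.dir.along p := by rw [hal, hal, hqac]
  obtain ⟨hl, hseg⟩ := h.of_mem_Ioo (p' := q) (hp.2 _) (by rwa [hqal]) hqac (by rwa [hqal])
  rw [hqal] at hseg
  refine ⟨q, ⟨hseg t right_mem_uIcc, fun d => ?_⟩, hqal, hqal', hl, ?_⟩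
  · by_cases hd : d = b.dir
    · rw [hd, hqal]
      exact hgen
    · rw [Orientation2.eq_of_ne_of_ne hd hdir.symm, hqal']
      exact hp.2 _
  · refine h'.of_along_eq hqal' fun x hx => ?_
    rw [hac, hac, hqal] at hx
    rw [hal, ← Orientation2.point_of_ne hdir]
    exact hseg x hx

/-- If the two chords of a generic point land on `b` and `b'`, then above any two generic positions
on `b` and on `b'` there is a common generic point. -/
lemma Lands.exists_common {p : ℝ × ℝ} {b b' : OrthoSegment} (hp : P.Generic p)
    (h : P.Lands p b) (h' : P.Lands p b') (hdir : b.dir ≠ b'.dir) {t t' : ℝ}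
    (ht : t ∈ Ioo b.lo b.hi) (hgen : P.GenericParam b.dir t)
    (ht' : t' ∈ Ioo b'.lo b'.hi) (hgen' : P.GenericParam b'.dir t') :
    ∃ q, P.Generic q ∧ b.dir.along q = t ∧ b'.dir.along q = t' ∧ P.Lands q b ∧ P.Lands q b' := by
  obtain ⟨q, hq, hqt, -, hl, hl'⟩ := h.exists_moved hp h' hdir ht hgen
  obtain ⟨r, hr, hrt', hrt, hrl', hrl⟩ := hl'.exists_moved hq hl hdir.symm ht' hgen'
  exact ⟨r, hr, hrt.trans hqt, hrt', hrl, hrl'⟩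

/-! ### Rectangles -/

/-- The chords of all generic points of one rectangle land on the same pieces. -/
lemma Lands.of_mem_component {p q : ℝ × ℝ} {b : OrthoSegment} (hp : P.Generic p)
    (h : P.Lands p b) (hq : P.Generic q) (hqp : q ∈ connectedComponentIn P.cutRegion p) :
    P.Lands q b := by
  set U := connectedComponentIn P.cutRegion p with hU
  have hUo : IsOpen U := P.isOpen_cutRegion.connectedComponentIn
  have hUsub : U ⊆ P.cutRegion := connectedComponentIn_subset _ _
  have hpU : p ∈ U := mem_connectedComponentIn hp.mem_cutRegion
  have hlocal : ∀ z ∈ U, (∀ᶠ r in 𝓝 z, P.Generic r → P.Lands r b) ∨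
      ∀ᶠ r in 𝓝 z, P.Generic r → ¬ P.Lands r b := by
    intro z hz
    obtain ⟨ε, hε, hball⟩ := Metric.isOpen_iff.1 hUo z hz
    have hbox : ∀ r ∈ Metric.ball z ε, b.dir.along r ∈ Ioo (b.dir.along z - ε) (b.dir.along z + ε) ∧
        b.dir.across r ∈ Ioo (b.dir.across z - ε) (b.dir.across z + ε) := by
      intro r hr
      rw [b.dir.mem_ball_iff, abs_lt, abs_lt] at hr
      exact ⟨⟨by linarith [hr.1.1], by linarith [hr.1.2]⟩,
        ⟨by linarith [hr.2.1], by linarith [hr.2.2]⟩⟩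
    have hbox' : ∀ x ∈ Ioo (b.dir.along z - ε) (b.dir.along z + ε),
        ∀ y ∈ Ioo (b.dir.across z - ε) (b.dir.across z + ε), b.dir.point x y ∈ P.cutRegion := by
      intro x hx y hy
      refine hUsub (hball ?_)
      rw [b.dir.mem_ball_iff, abs_lt, abs_lt, b.dir.along_point, b.dir.across_point]
      exact ⟨⟨by linarith [hx.1], by linarith [hx.2]⟩, ⟨by linarith [hy.1], by linarith [hy.2]⟩⟩
    by_cases hex : ∃ r ∈ Metric.ball z ε, P.Generic r ∧ P.Lands r b
    · left
      obtain ⟨r, hr, hrg, hrl⟩ := hex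
      filter_upwards [Metric.ball_mem_nhds z hε] with r' hr' hrg'
      -- Inside a square, move first perpendicularly and then parallel to `b`.
      have hmid : P.Lands (b.dir.point (b.dir.along r) (b.dir.across r')) b := by
        refine hrl.of_along_eq (by simp) fun x hx => P.cutRegion_subset_interior ?_
        rw [b.dir.across_point] at hx
        exact hbox' _ (hbox r hr).1 _
          (ordConnected_Ioo.uIcc_subset (hbox r hr).2 (hbox r' hr').2 hx)
      refine hmid.of_across_eq ?_ (hrg'.2 _) (by simp) fun x hx => ?_
      · simpa using hrg.2 b.dir
      · rw [b.dir.along_point] at hx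
        rw [b.dir.across_point]
        exact hbox' _ (ordConnected_Ioo.uIcc_subset (hbox r hr).1 (hbox r' hr').1 hx) _
          (hbox r' hr').2
    · right
      push Not at hex
      filter_upwards [Metric.ball_mem_nhds z hε] with r hr hrg
      exact hex r hr hrg
  by_contra hnot
  obtain ⟨z, hzU, hz₁, hz₂⟩ := isPreconnected_connectedComponentIn
    {z | ∀ᶠ r in 𝓝 z, P.Generic r → P.Lands r b} {z | ∀ᶠ r in 𝓝 z, P.Generic r → ¬ P.Lands r b}
    isOpen_setOfPred_eventually_nhds isOpen_setOfPred_eventually_nhds (fun z hz => hlocal z hz)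
    ⟨p, hpU, (hlocal p hpU).resolve_right fun h' => h'.self_of_nhds hp h⟩
    ⟨q, hqp, (hlocal q hqp).resolve_left fun h' => hnot (h'.self_of_nhds hq)⟩
  obtain ⟨r, hr, hr₁, hr₂⟩ :=
    ((frequently_generic (hUsub hzU).1).and_eventually (hz₁.and hz₂)).exists
  exact hr₂ hr (hr₁ hr)

lemma Lands.seesRegion {p : ℝ × ℝ} {b : OrthoSegment} (hp : P.Generic p) (h : P.Lands p b) :
    P.SeesRegion b (closure (connectedComponentIn P.cutRegion p)) := by
  have hUo : IsOpen (connectedComponentIn P.cutRegion p) :=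
    P.isOpen_cutRegion.connectedComponentIn
  refine closure_minimal (t := {z | P.Sees b z}) (fun z hz => ?_) (P.isClosed_sees b)
  rw [← (P.isClosed_sees b).closure_eq, mem_closure_iff_frequently]
  refine ((frequently_generic (connectedComponentIn_subset _ _ hz).1).and_eventually
    (hUo.mem_nhds hz)).mono fun q hq => ?_
  exact (h.of_mem_component hp hq.1 hq.2).sees

lemma exists_generic_mem_rectangle {R : Set (ℝ × ℝ)} (hR : R ∈ P.rectangles) :
    ∃ p ∈ R, P.Generic p := by
  obtain ⟨x, hx, rfl⟩ := hR
  have hsub : connectedComponentIn P.cutRegion x ⊆ P.cutRegion := connectedComponentIn_subset _ _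
  obtain ⟨p, hp, hgen⟩ := exists_generic P.isOpen_cutRegion.connectedComponentIn
    ⟨x, mem_connectedComponentIn hx⟩ (hsub.trans P.cutRegion_subset_interior)
  exact ⟨p, subset_closure hp, hgen⟩

/-! ### Vertex covers and covers -/

lemma finite_boundaryPieces (P : OrthogonalPolygon) : P.boundaryPieces.Finite := by
  set L : Set ℝ := OrthoSegment.level '' (P.edges : Set OrthoSegment) with hL
  have hLfin : L.Finite := P.edges.finite_toSet.image _
  have hdir : (univ : Set Orientation2).Finite :=
    (toFinite {Orientation2.horizontal, Orientation2.vertical}).subset fun d _ => by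
      cases d <;> simp
  refine Set.Finite.of_finite_image (f := fun b : OrthoSegment => (b.dir, b.level, b.lo, b.hi))
    ((hdir.prod (hLfin.prod (hLfin.prod hLfin))).subset ?_) ?_
  · rintro _ ⟨b, hb, rfl⟩
    obtain ⟨e, he, -, hl, -, -, -, h₁, h₂, -⟩ := exists_edge_of_mem_boundaryPieces hb
    obtain ⟨f, hf, -, hfl⟩ := h₁.exists_edge
    obtain ⟨g, hg, -, hgl⟩ := h₂.exists_edge
    exact ⟨mem_univ _, ⟨e, he, hl.symm⟩, ⟨f, hf, hfl⟩, ⟨g, hg, hgl⟩⟩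
  · intro b _ b' _ h
    cases b
    cases b'
    simp_all

lemma Lands.eq {p : ℝ × ℝ} {b b' : OrthoSegment} (hp : P.Generic p) (h : P.Lands p b)
    (h' : P.Lands p b') (hd : b'.dir = b.dir) : b' = b :=
  h.eq_of_sees hp h'.1 hd h'.sees

/-- A piece sees a generic point only if one of the two chords of the point lands on it. -/
lemma lands_of_sees {p : ℝ × ℝ} {b : OrthoSegment} (hp : P.Generic p)
    (hb : b ∈ P.boundaryPieces) (hs : P.Sees b p) : P.Lands p b := by
  obtain ⟨b', hd, hl⟩ := exists_lands hp b.dir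
  rwa [hl.eq_of_sees hp hb hd.symm hs]

/-- The edges of `G_P` are the pairs of pieces on which the two chords of a generic point land. -/
lemma isVertexCover_iff {S : Set P.boundaryPieces} : P.pieceGraph.IsVertexCover S ↔
    ∀ p, P.Generic p → ∃ b ∈ S, P.Lands p b.1 := by
  constructor
  · intro hS p hp
    obtain ⟨b, hbd, hb⟩ := exists_lands hp .horizontal
    obtain ⟨b', hbd', hb'⟩ := exists_lands hp .vertical
    have hadj : P.pieceGraph.Adj ⟨b, hb.1⟩ ⟨b', hb'.1⟩ := by
      refine ⟨fun h => ?_, _, ⟨p, hp.mem_cutRegion, rfl⟩, hb.seesRegion hp, hb'.seesRegion hp⟩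
      have : b = b' := congrArg Subtype.val h
      rw [this, hbd'] at hbd
      exact nomatch hbd
    rcases hS hadj with h | h
    exacts [⟨_, h, hb⟩, ⟨_, h, hb'⟩]
  · rintro hS ⟨a, ha⟩ ⟨b, hb⟩ ⟨hne, R, hR, haR, hbR⟩
    obtain ⟨p, hpR, hp⟩ := exists_generic_mem_rectangle hR
    have hla := lands_of_sees hp ha (haR p hpR)
    have hlb := lands_of_sees hp hb (hbR p hpR)
    obtain ⟨⟨c, hc⟩, hcS, hlc⟩ := hS p hp
    by_cases hca : c.dir = a.dir
    · left
      have := hla.eq hp hlc hca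
      subst this
      exact hcS
    · right
      have hab : b.dir ≠ a.dir := fun h => hne (Subtype.ext (hla.eq hp hlb h).symm)
      have := hlb.eq hp hlc (Orientation2.eq_of_ne_of_ne hca hab)
      subst this
      exact hcS

/-- Since visibility is a closed condition, it suffices to see the generic points. -/
lemma isCover_of_generic {C : Finset OrthoSegment} (hC : ∀ s ∈ C, s.toSet ⊆ P.carrier)
    (h : ∀ p, P.Generic p → ∃ s ∈ C, P.Sees s p) : P.IsCover C := by
  refine ⟨hC, fun z hz => ?_⟩
  have hcl : IsClosed (⋃ s ∈ C, {p | P.Sees s p}) :=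
    C.finite_toSet.isClosed_biUnion fun s _ => P.isClosed_sees s
  have hmem : z ∈ ⋃ s ∈ C, {p | P.Sees s p} := by
    rw [← hcl.closure_eq, mem_closure_iff_frequently]
    refine (frequently_generic hz).mono fun p hp => ?_
    obtain ⟨s, hs, hsp⟩ := h p hp
    exact mem_biUnion hs hsp
  simpa using hmem

lemma mem_segmentsOf {S : Finset P.boundaryPieces} {s : OrthoSegment} :
    s ∈ segmentsOf S ↔ ∃ b ∈ S, b.1 = s := by
  simp only [segmentsOf, Finset.mem_map, Function.Embedding.subtype_apply]

lemma isVertexCover_iff_isCover {S : Finset P.boundaryPieces} :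
    P.pieceGraph.IsVertexCover (S : Set P.boundaryPieces) ↔ P.IsCover (segmentsOf S) := by
  rw [isVertexCover_iff]
  constructor
  · intro h
    refine isCover_of_generic (fun s hs => ?_) fun p hp => ?_
    · obtain ⟨b, -, rfl⟩ := mem_segmentsOf.1 hs
      exact (subset_frontier_of_mem_boundaryPieces b.2).trans P.frontier_subset
    · obtain ⟨b, hb, hl⟩ := h p hp
      exact ⟨b.1, mem_segmentsOf.2 ⟨b, hb, rfl⟩, hl.sees⟩
  · intro h p hp
    obtain ⟨s, hs, hsp⟩ := h.2 p (interior_subset hp.1)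
    obtain ⟨b, hb, rfl⟩ := mem_segmentsOf.1 hs
    exact ⟨b, hb, lands_of_sees hp b.2 hsp⟩

lemma totalLength_segmentsOf (S : Finset P.boundaryPieces) :
    totalLength (segmentsOf S) = weight S := by
  simp [totalLength, segmentsOf, weight]

/-! ### From covers to vertex covers -/

/-- The parameters of the piece `b` at which a parallel camera `s` sees the piece. -/
def coveredParams (P : OrthogonalPolygon) (s b : OrthoSegment) : Set ℝ :=
  {t | t ∈ Ioo b.lo b.hi ∧ P.GenericParam b.dir t ∧ s.dir = b.dir ∧
    P.Sees s (b.dir.point t b.level)}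

/-- Almost every point of `b` is seen by a camera of `C` parallel to `b`. -/
def IsSwept (P : OrthogonalPolygon) (C : Finset OrthoSegment) (b : OrthoSegment) : Prop :=
  ∀ t ∈ Ioo b.lo b.hi, P.GenericParam b.dir t → ∃ s ∈ C, t ∈ P.coveredParams s b

lemma finite_not_genericParam (P : OrthogonalPolygon) (d : Orientation2) :
    {t | ¬ P.GenericParam d t}.Finite := by
  refine (P.edges.finite_toSet.image OrthoSegment.level).subset fun t ht => ?_
  simp only [GenericParam, Set.mem_ofPred_eq, not_forall, not_not] at ht
  obtain ⟨e, he, -, hl⟩ := ht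
  exact ⟨e, he, hl⟩

lemma measurableSet_coveredParams (P : OrthogonalPolygon) (s b : OrthoSegment) :
    MeasurableSet (P.coveredParams s b) := by
  have : P.coveredParams s b = Ioo b.lo b.hi ∩ ({t | ¬ P.GenericParam b.dir t}ᶜ ∩
      ({_t | s.dir = b.dir} ∩ (fun t => b.dir.point t b.level) ⁻¹' {p | P.Sees s p})) := by
    ext t
    simp [coveredParams]
  rw [this]
  refine measurableSet_Ioo.inter ((P.finite_not_genericParam _).measurableSet.compl.inter
    ((MeasurableSet.const _).inter ?_))
  exact ((P.isClosed_sees s).preimage (by fun_prop)).measurableSet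

/-- The pieces swept by a cover form a vertex cover: otherwise some generic point has chords landing
at a position of one piece and at a position of another piece that are both unseen by parallel
cameras, and such a point is not seen at all. -/
lemma IsCover.isVertexCover_swept {C : Finset OrthoSegment} (hC : P.IsCover C) :
    P.pieceGraph.IsVertexCover {b | P.IsSwept C b.1} := by
  rw [isVertexCover_iff]
  intro p hp
  obtain ⟨b, hbd, hb⟩ := exists_lands hp .horizontal
  obtain ⟨b', hbd', hb'⟩ := exists_lands hp .vertical
  by_contra! hnot
  have hns : ¬ P.IsSwept C b := fun h => hnot ⟨b, hb.1⟩ h hb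
  have hns' : ¬ P.IsSwept C b' := fun h => hnot ⟨b', hb'.1⟩ h hb'
  simp only [IsSwept, not_forall] at hns hns'
  obtain ⟨t, ht, hgen, hun⟩ := hns
  obtain ⟨t', ht', hgen', hun'⟩ := hns'
  obtain ⟨q, hq, hqt, hqt', hl, hl'⟩ :=
    hb.exists_common hp hb' (by rw [hbd, hbd']; nofun) ht hgen ht' hgen'
  obtain ⟨s, hs, hsq⟩ := hC.2 q (interior_subset hq.1)
  by_cases hd : s.dir = b.dir
  · refine hun ⟨s, hs, ht, hgen, hd, ?_⟩
    rw [← hqt]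
    exact (hl.sees_foot hd hsq).1
  · have hd' : s.dir = b'.dir :=
      Orientation2.eq_of_ne_of_ne hd (by rw [hbd, hbd']; nofun)
    refine hun' ⟨s, hs, ht', hgen', hd', ?_⟩
    rw [← hqt']
    exact (hl'.sees_foot hd' hsq).1

/-- Each camera sees, along its own orientation, disjoint parts of the pieces, of total measure at
most its length; so pieces swept by `C` weigh at most as much as `C`. -/
lemma weight_le_of_isSwept {C : Finset OrthoSegment} {S : Finset P.boundaryPieces}
    (hS : ∀ b ∈ S, P.IsSwept C b.1) : weight S ≤ totalLength C := by
  open MeasureTheory in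
  have hpiece : ∀ b ∈ S, ENNReal.ofReal b.1.length ≤ ∑ s ∈ C, volume (P.coveredParams s b.1) := by
    intro b hb
    calc ENNReal.ofReal b.1.length
        = volume (Ioo b.1.lo b.1.hi \ {t | ¬ P.GenericParam b.1.dir t}) := by
          rw [measure_sdiff_null ((P.finite_not_genericParam _).measure_zero _), Real.volume_Ioo]
          rfl
      _ ≤ volume (⋃ s ∈ C, P.coveredParams s b.1) := by
          refine measure_mono fun t ht => ?_
          obtain ⟨s, hs, hts⟩ := hS b hb t ht.1 (not_not.1 ht.2)
          exact mem_biUnion hs hts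
      _ ≤ _ := measure_biUnion_finset_le _ _
  open MeasureTheory in
  have hcamera : ∀ s ∈ C, ∑ b ∈ S, volume (P.coveredParams s b.1) ≤ ENNReal.ofReal s.length := by
    intro s _
    rw [← measure_biUnion_finset (fun b _ b' _ hne => ?_)
      fun b _ => P.measurableSet_coveredParams s b.1]
    · rw [OrthoSegment.length, ← Real.volume_Icc]
      refine measure_mono (iUnion₂_subset fun b _ t ht => ?_)
      have := (sees_iff.1 ht.2.2.2).1
      rwa [ht.2.2.1, Orientation2.along_point] at this
    · refine Set.disjoint_left.2 fun t ht ht' => hne (Subtype.ext ?_)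
      have hd : b.1.dir = b'.1.dir := ht.2.2.1.symm.trans ht'.2.2.1
      have hs := (sees_iff.1 ht.2.2.2).2
      have hs' := (sees_iff.1 ht'.2.2.2).2
      rw [ht.2.2.1] at hs
      rw [ht'.2.2.1] at hs'
      simp only [Orientation2.along_point, Orientation2.across_point] at hs hs'
      refine piece_eq_of_carrier b.2 b'.2 hd ht.1 ht'.1 fun x hx => ?_
      rcases uIcc_subset_uIcc_union_uIcc (b := s.level) hx with h | h
      · exact hs x (by rwa [uIcc_comm])
      · rw [hd]
        exact hs' x h
  have hlen : ∀ s : OrthoSegment, 0 ≤ s.length := fun s => (sub_pos.2 s.lo_lt_hi).le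
  have hsum : ENNReal.ofReal (weight S) ≤ ENNReal.ofReal (totalLength C) := by
    rw [weight, totalLength, ENNReal.ofReal_sum_of_nonneg fun b _ => hlen _,
      ENNReal.ofReal_sum_of_nonneg fun s _ => hlen s]
    refine (Finset.sum_le_sum hpiece).trans ?_
    rw [Finset.sum_comm]
    exact Finset.sum_le_sum hcamera
  exact (ENNReal.ofReal_le_ofReal_iff (Finset.sum_nonneg fun s _ => hlen s)).1 hsum

lemma IsCover.exists_isVertexCover {C : Finset OrthoSegment} (hC : P.IsCover C) :
    ∃ S : Finset P.boundaryPieces, P.pieceGraph.IsVertexCover (S : Set P.boundaryPieces) ∧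
      weight S ≤ totalLength C := by
  have : Finite P.boundaryPieces := P.finite_boundaryPieces
  refine ⟨(toFinite {b : P.boundaryPieces | P.IsSwept C b.1}).toFinset, ?_,
    weight_le_of_isSwept fun b hb => by simpa using hb⟩
  rw [Set.Finite.coe_toFinset]
  exact hC.isVertexCover_swept

lemma isMinWeightVertexCover_iff {S : Finset P.boundaryPieces} :
    IsMinWeightVertexCover S ↔ P.IsOptimalCover (segmentsOf S) := by
  refine and_congr isVertexCover_iff_isCover ⟨fun h C hC => ?_, fun h S' hS' => ?_⟩
  · obtain ⟨S', hS', hle⟩ := hC.exists_isVertexCover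
    rw [totalLength_segmentsOf]
    exact (h S' hS').trans hle
  · rw [← totalLength_segmentsOf, ← totalLength_segmentsOf]
    exact h _ (isVertexCover_iff_isCover.1 hS')

lemma exists_isMinWeightVertexCover (P : OrthogonalPolygon) :
    ∃ S : Finset P.boundaryPieces, IsMinWeightVertexCover S := by
  have : Finite P.boundaryPieces := P.finite_boundaryPieces
  obtain ⟨S, hS, hmin⟩ := Set.exists_min_image
    {S : Finset P.boundaryPieces | P.pieceGraph.IsVertexCover (S : Set P.boundaryPieces)} weight
    (toFinite _) ⟨(toFinite univ).toFinset, by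
      rw [Set.mem_ofPred_eq, Set.Finite.coe_toFinset]
      exact SimpleGraph.isVertexCover_univ⟩
  exact ⟨S, hS, hmin⟩

end OrthogonalPolygon

theorem mainTheorem3 (P : OrthogonalPolygon) :
    P.boundaryPieces.Finite ∧
    (∀ S : Finset P.boundaryPieces,
      (P.pieceGraph.IsVertexCover (S : Set P.boundaryPieces) ↔
        P.IsCover (OrthogonalPolygon.segmentsOf S)) ∧
      OrthogonalPolygon.totalLength (OrthogonalPolygon.segmentsOf S) =
        OrthogonalPolygon.weight S) ∧
    (∀ C : Finset OrthoSegment, P.IsCover C →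
      ∃ S : Finset P.boundaryPieces,
        P.pieceGraph.IsVertexCover (S : Set P.boundaryPieces) ∧
        OrthogonalPolygon.weight S ≤ OrthogonalPolygon.totalLength C ∧
        (P.IsOptimalCover C →
          OrthogonalPolygon.weight S = OrthogonalPolygon.totalLength C)) ∧
    (∀ S : Finset P.boundaryPieces,
      OrthogonalPolygon.IsMinWeightVertexCover S ↔
        P.IsOptimalCover (OrthogonalPolygon.segmentsOf S)) ∧
    (∃ m : ℝ,
      IsLeast {w : ℝ | ∃ S : Finset P.boundaryPieces,
        P.pieceGraph.IsVertexCover (S : Set P.boundaryPieces) ∧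
          OrthogonalPolygon.weight S = w} m ∧
      IsLeast {l : ℝ | ∃ C : Finset OrthoSegment,
        P.IsCover C ∧ OrthogonalPolygon.totalLength C = l} m) := by
  refine ⟨P.finite_boundaryPieces, fun S => ⟨OrthogonalPolygon.isVertexCover_iff_isCover,
    OrthogonalPolygon.totalLength_segmentsOf S⟩, fun C hC => ?_,
    fun S => OrthogonalPolygon.isMinWeightVertexCover_iff, ?_⟩
  · obtain ⟨S, hS, hle⟩ := hC.exists_isVertexCover
    refine ⟨S, hS, hle, fun hopt => hle.antisymm ?_⟩
    rw [← OrthogonalPolygon.totalLength_segmentsOf]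
    exact hopt.2 _ (OrthogonalPolygon.isVertexCover_iff_isCover.1 hS)
  · obtain ⟨S, hS⟩ := P.exists_isMinWeightVertexCover
    have hopt := OrthogonalPolygon.isMinWeightVertexCover_iff.1 hS
    refine ⟨OrthogonalPolygon.weight S, ⟨⟨S, hS.1, rfl⟩, ?_⟩,
      ⟨⟨_, hopt.1, OrthogonalPolygon.totalLength_segmentsOf S⟩, ?_⟩⟩
    · rintro _ ⟨S', hS', rfl⟩
      exact hS.2 S' hS'
    · rintro _ ⟨C, hC, rfl⟩
      rw [← OrthogonalPolygon.totalLength_segmentsOf]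
      exact hopt.2 C hC
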